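/- Let $d\ge 3$ be an integer. For $m\ge 0$ let $g_d(m)$ be the number of isomorphism classes of groups of order $2^m$ that admit a generating set consisting of exactly $d$ involutions. For a group $G$ and an inverse-closed, identity-free generating set $S$ of $G$, let $\mathrm{Cay}(G,S)$ be the graph with vertex set $G$ in which $u$ and $v$ are adjacent if and only if $uv^{-1}\in S$; regard $G$ as a subgroup of $\mathrm{Aut}(\mathrm{Cay}(G,S))$ through its regular action by right multiplication. Let $c_d(m)$ be the number of isomorphism classes of graphs $\Gamma=\mathrm{Cay}(G,S)$ of order $2^m$ such that the generating set $S$ consists of exactly $d$ involutions and the normalizer satisfies $N_{\mathrm{Aut}(\Gamma)}(G)=G$. Then, as $m\to\infty$ with $d$ fixed, $$g_d(m)\;\ge\; 2^{\frac{(d-2)^2}{8d}m^2+o(m^2)}\qquad\text{and}\qquad c_d(m)\;\ge\; 2^{\frac{(d-2)^2}{8d}m^2+o(m^2)}.$$ That is, for each of the two quantities there is a function $e:\mathbb{N}\to\mathbb{R}$ with $e(m)=o(m^2)$ such that the quantity is at least $2^{\frac{(d-2)^2}{8d}m^2+e(m)}$ for all sufficiently large $m$. -/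

import Mathlib

/-- `S` is a generating set of the group `G` consisting of (exactly) `d` involutions. -/
structure IsInvolutionGeneratingSet {G : Type*} [Group G] (d : ℕ) (S : Set G) : Prop where
  finite : S.Finite
  ncard_eq : S.ncard = d
  orderOf_eq_two : ∀ s ∈ S, orderOf s = 2
  closure_eq_top : Subgroup.closure S = ⊤

/-- The set of isomorphism classes of groups of order `2 ^ m` which admit a generating set
consisting of `d` involutions. -/
def involutionGroupClasses (d m : ℕ) :
    Set (Quotient (CategoryTheory.isIsomorphicSetoid GrpCat.{0})) :=
  {c | ∃ G : GrpCat.{0}, Quotient.mk _ G = c ∧ Nat.card G = 2 ^ m ∧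
    ∃ S : Set G, IsInvolutionGeneratingSet d S}

/-- `g_d(m)`: the number of isomorphism classes of groups of order `2 ^ m` which admit a
generating set consisting of `d` involutions. -/
noncomputable def numInvolutionGroups (d m : ℕ) : ℕ :=
  (involutionGroupClasses d m).ncard

/-- The set of isomorphism classes counted by `numInvolutionGroups` is finite, so that its
`Set.ncard` is its actual number of elements. -/
theorem involutionGroupClasses_finite (d m : ℕ) : (involutionGroupClasses d m).Finite := by
  have hfin : Finite (Group (Fin (2 ^ m))) :=
    Finite.of_injective
      (fun A : Group (Fin (2 ^ m)) => A.toMonoid.toMulOneClass.toMul.mul)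
      (fun A B h => Group.ext h)
  refine (Set.finite_range (fun A : Group (Fin (2 ^ m)) =>
    (Quotient.mk (CategoryTheory.isIsomorphicSetoid GrpCat.{0})
      (@GrpCat.of (Fin (2 ^ m)) A)))).subset ?_
  rintro c ⟨G, rfl, hG, -⟩
  have hGf : Finite G := Nat.finite_of_card_ne_zero (by rw [hG]; positivity)
  let e : Fin (2 ^ m) ≃ G := (Finite.equivFinOfCardEq hG).symm
  have key : ∀ (X : Type) (_ : Group X) (f : X ≃ G), (∀ x y, f (x * y) = f x * f y) →
      Nonempty (GrpCat.of X ≅ G) := fun X _ f hf =>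
    ⟨MulEquiv.toGrpIso (X := GrpCat.of X) (Y := G) { f with map_mul' := hf }⟩
  exact ⟨e.group, Quotient.sound (key _ e.group e fun x y => e.apply_symm_apply _)⟩

/-- The Cayley graph `Cay(G, S)`: distinct `u`, `v` are adjacent iff `u * v⁻¹ ∈ S`
(or `v * u⁻¹ ∈ S`, which is equivalent when `S` is inverse-closed). -/
def cayleyGraph {G : Type*} [Group G] (S : Set G) : SimpleGraph G :=
  SimpleGraph.fromRel fun u v => u * v⁻¹ ∈ S

/-- For an inverse-closed and identity-free `S`, adjacency in `Cay(G, S)` is `u * v⁻¹ ∈ S`. -/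
theorem cayleyGraph_adj {G : Type*} [Group G] {S : Set G} (hinv : ∀ s ∈ S, s⁻¹ ∈ S)
    (hone : (1 : G) ∉ S) (u v : G) : (cayleyGraph S).Adj u v ↔ u * v⁻¹ ∈ S := by
  rw [cayleyGraph, SimpleGraph.fromRel_adj]
  constructor
  · rintro ⟨-, h | h⟩
    · exact h
    · simpa using hinv _ h
  · intro h
    refine ⟨?_, Or.inl h⟩
    rintro rfl
    exact hone (by simpa using h)

/-- The regular representation of `G` by automorphisms of `Cay(G, S)`:
`g` acts as the permutation `u ↦ u * g⁻¹`. -/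
def cayleyRegularRep {G : Type*} [Group G] (S : Set G) :
    G →* (cayleyGraph S ≃g cayleyGraph S) where
  toFun g :=
    { toEquiv := Equiv.mulRight g⁻¹
      map_rel_iff' := by
        intro u v
        simp [cayleyGraph] }
  map_one' := by
    ext u
    simp
  map_mul' g h := by
    ext u
    simp [RelIso.mul_apply, mul_assoc]

/-- `N_{Aut Γ}(G) = G` for `Γ = Cay(G, S)`, where `G` is viewed as a subgroup of `Aut Γ` through
its regular representation. -/
def IsSelfNormalizingCayley {G : Type*} [Group G] (S : Set G) : Prop :=
  Subgroup.normalizer ((cayleyRegularRep S).range : Set (cayleyGraph S ≃g cayleyGraph S)) =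
    (cayleyRegularRep S).range

/-- Isomorphism of graphs with vertex-set `Fin n`. -/
def graphIsoSetoid (n : ℕ) : Setoid (SimpleGraph (Fin n)) where
  r Γ Δ := Nonempty (Γ ≃g Δ)
  iseqv := ⟨fun _ => ⟨SimpleGraph.Iso.refl⟩, fun ⟨e⟩ => ⟨e.symm⟩, fun ⟨e⟩ ⟨f⟩ => ⟨e.trans f⟩⟩

/-- The number of isomorphism classes of Cayley graphs `Γ = Cay(G, S)` of order `2 ^ m` with `S` a
generating set of `G` consisting of `d` involutions and with `N_{Aut Γ}(G) = G`. An isomorphism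
class of graphs of order `n` is represented by a graph with vertex-set `Fin n`. -/
noncomputable def numSelfNormalizingCayleyGraphs (d m : ℕ) : ℕ :=
  Set.ncard {c : Quotient (graphIsoSetoid (2 ^ m)) |
    ∃ Δ : SimpleGraph (Fin (2 ^ m)), Quotient.mk _ Δ = c ∧
      ∃ (G : Type) (_ : Group G) (S : Set G), IsInvolutionGeneratingSet d S ∧
        IsSelfNormalizingCayley S ∧ Nonempty (Δ ≃g cayleyGraph S)}

/-! Put δ = d - 2. The classes counted are those of quotients of one large 2-group by many subgroups
of its centre.

Let B = F_2[X]/(X^n), V = B^δ × B^δ, and form a class-two group on V whose central fibre is the δ ×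
δ matrices over B. A dihedral group of order 2^(s+1), with n ≤ 2^s, acts on it and fixes the fibre
pointwise: its rotation scales the two halves of V by z and z⁻¹, where z = 1 + X, and its
reflections exchange them. Powers of z span B additively and commutators fill the fibre, so two
reflections and δ involutions over V generate the semidirect product. Thus d involutions generate a
group with a central elementary abelian subgroup of rank nδ² and index only 2^(2nδ+s+1)
(`exists_involution_tower`).

Dividing by its subgroups of rank t = nδ² - J, of which there are at least 2^(tJ), gives groups of
order 2^m with m = 2nδ + J + O(log m). Each isomorphism class arises at most 2^(md) times, since an
epimorphism is determined by the images of d generators. With y = nδ the main term is tJ ≈ (m -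
2y)(dy - m), largest midway between its zeros m/2 and m/d. There J ≈ δm/(2d) and t ≈ δm/4, which
gives the constant δ²/(8d).

To control normalizers, each generator is first paired with an involution of a product M of dihedral
groups, so that products of two generators have pairwise different orders; this costs O(log m) in
the exponent. The generating set is then fixed by no nontrivial automorphism, so G is
self-normalizing in Aut(Γ), hence a Sylow 2-subgroup, and the graph determines G. A lower bound for
`selfNormalizingClasses` therefore serves both counts. -/

/-! ### The coefficient ring F_2[X]/(X^n) -/

open Polynomial in
/-- A commutative ring of order `2 ^ n` and characteristic two which is additively generated by the
powers of a unit `z` of `2`-power order and has an endomorphism that inverts `z`. -/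
theorem exists_unipotent_ring {n s : ℕ} (hn : n ≤ 2 ^ s) :
    ∃ (B : Type) (_ : CommRing B) (_ : Finite B) (z : Bˣ) (σ : B →+* B),
      Nat.card B = 2 ^ n ∧ (∀ x : B, x + x = 0) ∧ z ^ (2 ^ s) = 1 ∧ σ z = (z⁻¹ : Bˣ) ∧
      AddSubgroup.closure (Set.range fun k : ℕ => (z : B) ^ k) = ⊤ := by
  have hmonic : ((X : (ZMod 2)[X]) ^ n).Monic := monic_X_pow n
  let B := AdjoinRoot ((X : (ZMod 2)[X]) ^ n)
  let ρ : B := AdjoinRoot.root _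
  have hρ : ρ ^ n = 0 := by
    have := AdjoinRoot.mk_self (f := (X : (ZMod 2)[X]) ^ n)
    rwa [map_pow, AdjoinRoot.mk_X] at this
  have hadd : ∀ x : B, x + x = 0 := fun x => by
    have h2 : (2 : ZMod 2) = 0 := by decide
    have h : (2 : B) = 0 := by
      rw [← map_ofNat (algebraMap (ZMod 2) B) 2, ← map_zero (algebraMap (ZMod 2) B)]
      exact congrArg _ h2
    rw [← two_mul, h, zero_mul]
  have hpow : ∀ (x : B) (k : ℕ), (1 + x) ^ (2 ^ k) = 1 + x ^ (2 ^ k) := by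
    intro x k
    induction k with
    | zero => simp
    | succ k ih =>
      rw [pow_succ, pow_mul, ih, pow_mul, pow_two, pow_two]
      linear_combination hadd (x ^ 2 ^ k)
  have hz : (1 + ρ) ^ (2 ^ s) = 1 := by
    rw [hpow, pow_eq_zero_of_le hn hρ, add_zero]
  let z : Bˣ := Units.ofPowEqOne (1 + ρ) (2 ^ s) hz (by positivity)
  have hzval : (z : B) = 1 + ρ := rfl
  have hzinv : ((z⁻¹ : Bˣ) : B) * (1 + ρ) = 1 := by rw [← hzval]; exact z.inv_mul
  -- z⁻¹ - 1 is a multiple of ρ, so ρ ↦ z⁻¹ - 1 respects the relation ρ^n = 0 and defines σ.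
  have hnil : (((z⁻¹ : Bˣ) : B) - 1) ^ n = 0 := by
    have h : ((z⁻¹ : Bˣ) : B) - 1 = -((z⁻¹ : Bˣ) : B) * ρ := by linear_combination hzinv
    rw [h, mul_pow, hρ, mul_zero]
  let σ : B →+* B := AdjoinRoot.lift (algebraMap (ZMod 2) B) (((z⁻¹ : Bˣ) : B) - 1) (by
    rw [eval₂_pow, eval₂_X, hnil])
  have : Module.Finite (ZMod 2) B := hmonic.finite_adjoinRoot
  have hfin : Finite B := Module.finite_of_finite (ZMod 2)
  refine ⟨B, inferInstance, hfin, z, σ, ?_, hadd, ?_, ?_, ?_⟩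
  · have h := Module.natCard_eq_pow_finrank (K := ZMod 2) (V := B)
    rw [h, Nat.card_zmod]
    congr 1
    rw [PowerBasis.finrank (AdjoinRoot.powerBasis' hmonic)]
    simp
  · ext
    rw [Units.val_pow_eq_pow_val, hzval, hz, Units.val_one]
  · rw [hzval, map_add, map_one]
    rw [show σ ρ = ((z⁻¹ : Bˣ) : B) - 1 from AdjoinRoot.lift_root _]
    ring
  · rw [eq_top_iff]
    rintro x -
    obtain ⟨p, rfl⟩ := AdjoinRoot.mk_surjective x
    -- Substituting ρ = z - 1 turns a polynomial in ρ into one in z; over F_2 this is a plain sum of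
    -- powers of z.
    have hx : AdjoinRoot.mk (X ^ n) p = aeval (z : B) (p.comp (X - 1)) := by
      rw [aeval_comp, hzval]
      simp only [map_sub, aeval_X, map_one, add_sub_cancel_left]
      exact (AdjoinRoot.aeval_eq p).symm
    rw [hx, aeval_eq_sum_range]
    refine AddSubgroup.sum_mem _ fun i _ => ?_
    have hc : ∀ c : ZMod 2, c = 0 ∨ c = 1 := by decide
    rcases hc ((p.comp (X - 1)).coeff i) with h | h
    · rw [h, zero_smul]; exact zero_mem _
    · rw [h, one_smul]; exact AddSubgroup.subset_closure ⟨i, rfl⟩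

/-! ### Class-two groups from biadditive cocycles -/

/-- The central extension of `V` by `Z` with cocycle a biadditive map `f`. -/
@[ext] structure BilinExt {V Z : Type} [AddCommGroup V] [AddCommGroup Z] (f : V →+ V →+ Z) where
  base : V
  fiber : Z

namespace BilinExt

variable {V Z : Type} [AddCommGroup V] [AddCommGroup Z] {f : V →+ V →+ Z}

instance : Mul (BilinExt f) := ⟨fun x y => ⟨x.base + y.base, x.fiber + y.fiber + f x.base y.base⟩⟩
instance : One (BilinExt f) := ⟨⟨0, 0⟩⟩
instance : Inv (BilinExt f) := ⟨fun x => ⟨-x.base, -x.fiber + f x.base x.base⟩⟩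

@[simp] theorem mul_base (x y : BilinExt f) : (x * y).base = x.base + y.base := rfl
@[simp] theorem mul_fiber (x y : BilinExt f) :
    (x * y).fiber = x.fiber + y.fiber + f x.base y.base := rfl
@[simp] theorem one_base : (1 : BilinExt f).base = 0 := rfl
@[simp] theorem one_fiber : (1 : BilinExt f).fiber = 0 := rfl
@[simp] theorem inv_base (x : BilinExt f) : x⁻¹.base = -x.base := rfl
@[simp] theorem inv_fiber (x : BilinExt f) : x⁻¹.fiber = -x.fiber + f x.base x.base := rfl

instance : Group (BilinExt f) :=
  Group.ofLeftAxioms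
    (fun x y z => by
      ext
      · simp [add_assoc]
      · simp only [mul_base, mul_fiber, map_add, AddMonoidHom.add_apply]
        abel)
    (fun x => by ext <;> simp)
    (fun x => by ext <;> simp)

/-- A pair `(v, z)` as an element of the extension, as an equivalence. -/
def equivProd (f : V →+ V →+ Z) : BilinExt f ≃ V × Z where
  toFun x := (x.base, x.fiber)
  invFun p := ⟨p.1, p.2⟩

instance [Finite V] [Finite Z] : Finite (BilinExt f) := Finite.of_equiv _ (equivProd f).symm

theorem natCard (f : V →+ V →+ Z) : Nat.card (BilinExt f) = Nat.card V * Nat.card Z := by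
  rw [Nat.card_congr (equivProd f), Nat.card_prod]

/-- The central fibre as a homomorphism. -/
def ofFiber (f : V →+ V →+ Z) : Multiplicative Z →* BilinExt f where
  toFun w := ⟨0, w.toAdd⟩
  map_one' := rfl
  map_mul' x y := by ext <;> simp

/-- The automorphism `(v, z) ↦ (L v, z + Q v)`, which has order at most two. -/
def involutiveAut (L : V →+ V) (Q : V → Z) (hL : ∀ v, L (L v) = v) (hQ : ∀ v, Q v + Q (L v) = 0)
    (h : ∀ u v, f (L u) (L v) + Q u + Q v = f u v + Q (u + v)) : MulAut (BilinExt f) where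
  toFun x := ⟨L x.base, x.fiber + Q x.base⟩
  invFun x := ⟨L x.base, x.fiber + Q x.base⟩
  left_inv x := by ext <;> simp [hL, add_assoc, hQ]
  right_inv x := by ext <;> simp [hL, add_assoc, hQ]
  map_mul' x y := by
    ext
    · simp
    · simp only [mul_base, mul_fiber]
      rw [add_assoc _ (f _ _), ← h]
      abel

end BilinExt

/-! ### Homomorphisms from dihedral groups -/

/-- The homomorphism `i ↦ g ^ i` from the cyclic group of order `q`. -/
def zmodPowHom {G : Type*} [Group G] {q : ℕ} (g : G) (hg : g ^ q = 1) :
    Multiplicative (ZMod q) →* G :=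
  AddMonoidHom.toMultiplicativeLeft
    (ZMod.lift q ⟨zmultiplesHom (Additive G) (Additive.ofMul g), by
      rw [zmultiplesHom_apply, natCast_zsmul, ← ofMul_pow, hg, ofMul_one]⟩)

theorem zmodPowHom_intCast {G : Type*} [Group G] {q : ℕ} (g : G) (hg : g ^ q = 1) (k : ℤ) :
    zmodPowHom g hg (Multiplicative.ofAdd (k : ZMod q)) = g ^ k := by
  change Additive.toMul (ZMod.lift q _ (k : ZMod q)) = _
  rw [ZMod.lift_coe]
  simp

/-- The homomorphism from a dihedral group determined by two involutions. -/
def dihedralLift {G : Type*} [Group G] {q : ℕ} (x y : G) (hx : x * x = 1) (hy : y * y = 1)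
    (hxy : (x * y) ^ q = 1) : DihedralGroup q →* G := by
  let ρ := zmodPowHom (x * y) hxy
  -- Conjugation by x inverts x * y, hence all its powers.
  have key : ∀ i : Multiplicative (ZMod q), ρ i * x = x * (ρ i)⁻¹ := by
    intro i
    obtain ⟨k, hk⟩ := ZMod.intCast_surjective i.toAdd
    have hρ : ρ i = (x * y) ^ k := by
      rw [← ofAdd_toAdd i, ← hk, zmodPowHom_intCast]
    have hconj : x * (x * y) * x⁻¹ = (x * y)⁻¹ := by
      rw [mul_inv_rev, ← mul_assoc, hx, one_mul, inv_eq_of_mul_eq_one_right hy]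
    have := conj_zpow (i := k) (a := x) (b := x * y)
    rw [hconj, inv_zpow] at this
    rw [hρ, this]
    simp only [← mul_assoc, hx, one_mul]
    rw [inv_eq_of_mul_eq_one_right hx]
  exact
  { toFun := fun g => match g with
      | .r i => ρ (Multiplicative.ofAdd i)
      | .sr i => x * ρ (Multiplicative.ofAdd i)
    map_one' := by
      change ρ (Multiplicative.ofAdd 0) = 1
      rw [ofAdd_zero, map_one]
    map_mul' := by
      rintro (i | i) (j | j)
      · simp [DihedralGroup.r_mul_r, ofAdd_add]
      · simp only [DihedralGroup.r_mul_sr, ofAdd_sub]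
        rw [← mul_assoc, key, mul_assoc, ← map_inv, ← map_mul, div_eq_inv_mul]
      · simp [DihedralGroup.sr_mul_r, ofAdd_add, mul_assoc]
      · simp only [DihedralGroup.sr_mul_sr, ofAdd_sub]
        rw [← mul_assoc, mul_assoc x, key, ← mul_assoc, hx, one_mul, ← map_inv, ← map_mul,
          div_eq_inv_mul] }

theorem dihedralLift_sr_zero {G : Type*} [Group G] {q : ℕ} (x y : G) (hx : x * x = 1)
    (hy : y * y = 1) (hxy : (x * y) ^ q = 1) :
    dihedralLift x y hx hy hxy (.sr 0) = x := by
  simp [dihedralLift]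

theorem dihedralLift_r_one {G : Type*} [Group G] {q : ℕ} (x y : G) (hx : x * x = 1)
    (hy : y * y = 1) (hxy : (x * y) ^ q = 1) :
    dihedralLift x y hx hy hxy (.r 1) = x * y := by
  have := zmodPowHom_intCast (x * y) hxy 1
  rwa [Int.cast_one, zpow_one] at this

theorem dihedralLift_sr_one {G : Type*} [Group G] {q : ℕ} (x y : G) (hx : x * x = 1)
    (hy : y * y = 1) (hxy : (x * y) ^ q = 1) :
    dihedralLift x y hx hy hxy (.sr 1) = y := by
  have h : (.sr 1 : DihedralGroup q) = .sr 0 * .r 1 := by simp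
  rw [h, map_mul, dihedralLift_sr_zero, dihedralLift_r_one, ← mul_assoc, hx, one_mul]

theorem DihedralGroup.closure_sr (q : ℕ) :
    Subgroup.closure {(.sr 0 : DihedralGroup q), .sr 1} = ⊤ := by
  set C := Subgroup.closure {(.sr 0 : DihedralGroup q), .sr 1}
  have h0 : (.sr 0 : DihedralGroup q) ∈ C := Subgroup.subset_closure (by simp)
  have h1 : (.sr 1 : DihedralGroup q) ∈ C := Subgroup.subset_closure (by simp)
  have hr : ∀ i : ZMod q, (.r i : DihedralGroup q) ∈ C := by
    intro i
    obtain ⟨k, rfl⟩ := ZMod.intCast_surjective i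
    rw [← DihedralGroup.r_one_zpow]
    exact zpow_mem (by simpa using mul_mem h0 h1) k
  rw [eq_top_iff]
  rintro (i | i) -
  · exact hr i
  · simpa using mul_mem h0 (hr i)

/-! ### The matrix-valued cocycle and its dihedral symmetry -/

namespace DihedralTower

variable {B : Type} [CommRing B] {δ : ℕ}

/-- The biadditive cocycle on `B ^ δ × B ^ δ` with values in `δ × δ` matrices. -/
def cocycle (δ : ℕ) (σ : B →+* B) :
    ((Fin δ → B) × (Fin δ → B)) →+ ((Fin δ → B) × (Fin δ → B)) →+ (Fin δ → Fin δ → B) :=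
  AddMonoidHom.mk' (fun u => AddMonoidHom.mk' (fun v i j =>
      if i < j then u.1 i * v.2 j + u.2 i * v.1 j
      else if i = j then u.1 i * v.2 i
      else σ (u.1 j) * v.1 i + σ (u.2 j) * v.2 i) (by
        intro v w
        funext i j
        simp only [Prod.fst_add, Prod.snd_add, Pi.add_apply]
        split_ifs <;> ring)) (by
    intro u v
    ext w i j
    simp only [AddMonoidHom.mk'_apply, AddMonoidHom.add_apply, Prod.fst_add, Prod.snd_add,
      Pi.add_apply, map_add]
    split_ifs <;> ring)

theorem cocycle_apply (σ : B →+* B) (u v : (Fin δ → B) × (Fin δ → B)) (i j : Fin δ) :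
    cocycle δ σ u v i j =
      if i < j then u.1 i * v.2 j + u.2 i * v.1 j
      else if i = j then u.1 i * v.2 i
      else σ (u.1 j) * v.1 i + σ (u.2 j) * v.2 i := rfl

/-- The exchange `(a, b) ↦ (z⁻¹ b, z a)`. -/
def reflect (δ : ℕ) (z : Bˣ) : ((Fin δ → B) × (Fin δ → B)) →+ ((Fin δ → B) × (Fin δ → B)) where
  toFun u := (fun i => (z⁻¹ : Bˣ) * u.2 i, fun i => z * u.1 i)
  map_zero' := by ext <;> simp
  map_add' u v := by ext <;> simp [mul_add]

/-- The quadratic correction of `reflect`. -/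
def diagForm (u : (Fin δ → B) × (Fin δ → B)) (i j : Fin δ) : B :=
  if i = j then u.1 i * u.2 i else 0

variable (h2 : ∀ x : B, x + x = 0) (σ : B →+* B) (z : Bˣ) (hσz : σ z = (z⁻¹ : Bˣ))

theorem reflect_reflect (u : (Fin δ → B) × (Fin δ → B)) :
    reflect δ z (reflect δ z u) = u := by
  ext i <;> simp [reflect]

include h2 in
theorem diagForm_add_reflect (u : (Fin δ → B) × (Fin δ → B)) :
    diagForm u + diagForm (reflect δ z u) = 0 := by
  funext i j
  simp only [diagForm, reflect, AddMonoidHom.coe_mk, ZeroHom.coe_mk, Pi.add_apply, Pi.zero_apply]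
  split_ifs
  · have hz : ((z⁻¹ : Bˣ) : B) * z = 1 := z.inv_mul
    linear_combination (u.1 i * u.2 i) * hz + h2 (u.1 i * u.2 i)
  · simp

-- Off the diagonal the cocycle is invariant: above it the factors z and z⁻¹ meet directly, below it
-- because σ inverts z. On the diagonal a_i b'_i becomes b_i a'_i, and the difference is the
-- polarization of the quadratic form a_i b_i, which `diagForm` absorbs.
include h2 hσz in
theorem cocycle_reflect (u v : (Fin δ → B) × (Fin δ → B)) :
    cocycle δ σ (reflect δ z u) (reflect δ z v) + diagForm u + diagForm v =
      cocycle δ σ u v + diagForm (u + v) := by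
  have hz : ((z⁻¹ : Bˣ) : B) * z = 1 := z.inv_mul
  have hσz' : σ (z⁻¹ : Bˣ) = z := by
    have h := congrArg σ hz
    rw [map_mul, map_one, hσz] at h
    linear_combination (z : B) * h - σ (z⁻¹ : Bˣ) * hz
  funext i j
  simp only [Pi.add_apply, cocycle_apply, diagForm, reflect, AddMonoidHom.coe_mk, ZeroHom.coe_mk,
    Prod.fst_add, Prod.snd_add, map_mul, hσz, hσz']
  rcases lt_trichotomy i j with h | h | h
  · simp only [h, if_true, h.ne, if_false]
    linear_combination (u.2 i * v.1 j + u.1 i * v.2 j) * hz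
  · subst h
    simp only [lt_irrefl, if_true, if_false]
    linear_combination (u.2 i * v.1 i) * hz - h2 (u.1 i * v.2 i)
  · simp only [h.not_gt, h.ne', if_false]
    linear_combination (σ (u.2 j) * v.2 i + σ (u.1 j) * v.1 i) * hz

/-- The involutive automorphism of the class-two group which lifts `reflect`. -/
def reflectAut (δ : ℕ) : MulAut (BilinExt (cocycle δ σ)) :=
  BilinExt.involutiveAut (reflect δ z) diagForm (reflect_reflect z) (diagForm_add_reflect h2 z)
    (cocycle_reflect h2 σ z hσz)

theorem reflectAut_base (x : BilinExt (cocycle δ σ)) :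
    (reflectAut h2 σ z hσz δ x).base = reflect δ z x.base := rfl

theorem reflectAut_fiber (x : BilinExt (cocycle δ σ)) :
    (reflectAut h2 σ z hσz δ x).fiber = x.fiber + diagForm x.base := rfl

theorem reflectAut_mul_self :
    reflectAut h2 σ z hσz δ * reflectAut h2 σ z hσz δ = 1 := by
  ext x : 1
  exact (reflectAut h2 σ z hσz δ).left_inv x

-- The two reflections add the same diagonal correction, which cancels in characteristic two; the
-- rotation therefore leaves the fibre coordinate unchanged.
include h2 in
theorem reflectAut_one_mul_apply (h1 : σ (1 : Bˣ) = ((1 : Bˣ)⁻¹ : Bˣ))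
    (x : BilinExt (cocycle δ σ)) :
    (reflectAut h2 σ 1 h1 δ * reflectAut h2 σ z hσz δ) x =
      ⟨(fun i => z * x.base.1 i, fun i => (z⁻¹ : Bˣ) * x.base.2 i), x.fiber⟩ := by
  have hz : ((z⁻¹ : Bˣ) : B) * z = 1 := z.inv_mul
  rw [MulAut.mul_apply]
  ext i j
  · simp [reflectAut_base, reflect]
  · simp [reflectAut_base, reflect]
  · simp only [reflectAut_base, reflectAut_fiber, Pi.add_apply, diagForm, reflect,
      AddMonoidHom.coe_mk, ZeroHom.coe_mk]
    split_ifs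
    · linear_combination (x.base.1 i * x.base.2 i) * hz + h2 (x.base.1 i * x.base.2 i)
    · simp

theorem reflectAut_one_mul_pow (h1 : σ (1 : Bˣ) = ((1 : Bˣ)⁻¹ : Bˣ)) (k : ℕ)
    (x : BilinExt (cocycle δ σ)) :
    ((reflectAut h2 σ 1 h1 δ * reflectAut h2 σ z hσz δ) ^ k) x =
      ⟨(fun i => ((z ^ k : Bˣ) : B) * x.base.1 i, fun i => ((z ^ k : Bˣ)⁻¹ : Bˣ) * x.base.2 i),
        x.fiber⟩ := by
  induction k with
  | zero => ext <;> simp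
  | succ k ih =>
    rw [pow_succ', MulAut.mul_apply, ih, reflectAut_one_mul_apply]
    ext
    · simp only [Units.val_pow_eq_pow_val]; ring
    · simp only [← inv_pow, Units.val_pow_eq_pow_val]; ring
    · simp

end DihedralTower

/-! ### Generating the class-two group -/

theorem addSubgroup_eq_top_of_pi_single_mem {ι B : Type*} [Finite ι] [DecidableEq ι] [AddCommGroup B]
    (A : AddSubgroup (ι → B)) (h : ∀ i x, Pi.single i x ∈ A) : A = ⊤ := by
  cases nonempty_fintype ι
  rw [eq_top_iff]
  rintro x -
  rw [← Finset.univ_sum_single x]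
  exact A.sum_mem fun i _ => h i (x i)

namespace DihedralTower

variable {B : Type} [CommRing B] {δ : ℕ}

/-- Entries on or above the diagonal come from pairing the two halves of V. Those below come from
two vectors of the first half, with 1 in the argument twisted by σ so that x appears untwisted. -/
theorem cocycle_commutator_of_le (σ : B →+* B) {i j : Fin δ} (hij : i ≤ j) (x : B) :
    cocycle δ σ (Pi.single i x, 0) (0, Pi.single j 1) -
      cocycle δ σ (0, Pi.single j 1) (Pi.single i x, 0) = Pi.single i (Pi.single j x) := by
  funext k l
  simp only [Pi.sub_apply, cocycle_apply, Pi.single_apply, Pi.zero_apply, ite_apply]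
  by_cases hk : k = i <;> by_cases hl : l = j <;> simp_all <;> grind

theorem cocycle_commutator_of_lt (σ : B →+* B) {i j : Fin δ} (hij : j < i) (x : B) :
    cocycle δ σ (Pi.single j 1, 0) (Pi.single i x, 0) -
      cocycle δ σ (Pi.single i x, 0) (Pi.single j 1, 0) = Pi.single i (Pi.single j x) := by
  funext k l
  simp only [Pi.sub_apply, cocycle_apply, Pi.single_apply, Pi.zero_apply, ite_apply]
  by_cases hk : k = i <;> by_cases hl : l = j <;> simp_all <;> grind

end DihedralTower

theorem BilinExt.pow_four {V Z : Type} [AddCommGroup V] [AddCommGroup Z] {f : V →+ V →+ Z}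
    (hV : ∀ v : V, v + v = 0) (hZ : ∀ w : Z, w + w = 0) (x : BilinExt f) : x ^ 4 = 1 := by
  have h : ∀ y : BilinExt f, y ^ 2 = ⟨0, f y.base y.base⟩ := by
    intro y
    rw [pow_two]
    ext
    · simp [hV]
    · simp [hZ]
  rw [show 4 = 2 * 2 from rfl, pow_mul, h (x ^ 2), h x]
  ext <;> simp

namespace BilinExt

variable {V Z : Type} [AddCommGroup V] [AddCommGroup Z] {f : V →+ V →+ Z}

/-- The projection of a subgroup of the extension to the base. -/
def baseSubgroup (K : Subgroup (BilinExt f)) : AddSubgroup V where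
  carrier := {v | ∃ x ∈ K, x.base = v}
  zero_mem' := ⟨1, one_mem K, rfl⟩
  add_mem' := by
    rintro _ _ ⟨x, hx, rfl⟩ ⟨y, hy, rfl⟩
    exact ⟨x * y, mul_mem hx hy, rfl⟩
  neg_mem' := by
    rintro _ ⟨x, hx, rfl⟩
    exact ⟨x⁻¹, inv_mem hx, rfl⟩

/-- The intersection of a subgroup of the extension with the fibre. -/
def fiberSubgroup (K : Subgroup (BilinExt f)) : AddSubgroup Z where
  carrier := {w | (⟨0, w⟩ : BilinExt f) ∈ K}
  zero_mem' := one_mem K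
  add_mem' {w w'} hw hw' := by
    have h : (⟨0, w + w'⟩ : BilinExt f) = ⟨0, w⟩ * ⟨0, w'⟩ := by ext <;> simp
    change _ ∈ K
    rw [h]
    exact K.mul_mem hw hw'
  neg_mem' {w} hw := by
    have h : (⟨0, -w⟩ : BilinExt f) = ⟨0, w⟩⁻¹ := by ext <;> simp
    change _ ∈ K
    rw [h]
    exact K.inv_mem hw

/-- The fibre is central, so a commutator depends only on the base components and any lifts in K may
be used. -/
theorem commutator_mem_fiberSubgroup {K : Subgroup (BilinExt f)} (hK : baseSubgroup K = ⊤)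
    (u v : V) : f u v - f v u ∈ fiberSubgroup K := by
  obtain ⟨x, hx, rfl⟩ : u ∈ baseSubgroup K := hK ▸ AddSubgroup.mem_top u
  obtain ⟨y, hy, rfl⟩ : v ∈ baseSubgroup K := hK ▸ AddSubgroup.mem_top v
  have h : (⟨0, f x.base y.base - f y.base x.base⟩ : BilinExt f) = x * y * (y * x)⁻¹ := by
    ext : 1
    · simp only [mul_base, inv_base]
      abel
    · simp only [mul_fiber, mul_base, inv_fiber, inv_base, map_neg, map_add,
        AddMonoidHom.add_apply]
      abel
  change _ ∈ K
  rw [h]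
  exact mul_mem (mul_mem hx hy) (inv_mem (mul_mem hy hx))

theorem eq_top_of_subgroups {K : Subgroup (BilinExt f)} (hb : baseSubgroup K = ⊤)
    (hf : fiberSubgroup K = ⊤) : K = ⊤ := by
  rw [eq_top_iff]
  rintro x -
  obtain ⟨y, hy, hyx⟩ : x.base ∈ baseSubgroup K := hb ▸ AddSubgroup.mem_top _
  have hw : x.fiber - y.fiber ∈ fiberSubgroup K := hf ▸ AddSubgroup.mem_top _
  have h : x = y * ⟨0, x.fiber - y.fiber⟩ := by
    ext : 1
    · simp [hyx]
    · simp
  rw [h]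
  exact K.mul_mem hy hw

end BilinExt

namespace DihedralTower

variable {B : Type} [CommRing B] {δ : ℕ}

/-- Commutators already give every elementary matrix, so generation need only be checked on the
base. -/
theorem fiberSubgroup_eq_top (σ : B →+* B) {K : Subgroup (BilinExt (cocycle δ σ))}
    (hK : BilinExt.baseSubgroup K = ⊤) : BilinExt.fiberSubgroup K = ⊤ := by
  have hsingle : ∀ i j x,
      (Pi.single i (Pi.single j x) : Fin δ → Fin δ → B) ∈ BilinExt.fiberSubgroup K := by
    intro i j x
    rcases le_or_gt i j with h | h
    · rw [← cocycle_commutator_of_le σ h]; exact BilinExt.commutator_mem_fiberSubgroup hK _ _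
    · rw [← cocycle_commutator_of_lt σ h]; exact BilinExt.commutator_mem_fiberSubgroup hK _ _
  refine addSubgroup_eq_top_of_pi_single_mem _ fun i x => ?_
  have := addSubgroup_eq_top_of_pi_single_mem
    ((BilinExt.fiberSubgroup K).comap (AddMonoidHom.single (fun _ => Fin δ → B) i)) (hsingle i)
  exact (this ▸ AddSubgroup.mem_top x :
    x ∈ (BilinExt.fiberSubgroup K).comap (AddMonoidHom.single (fun _ => Fin δ → B) i))

/-- The first hypothesis on A supplies the rotation orbits of the basis vectors, which span the
first half; the second is the exchange by a reflection. -/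
theorem prod_eq_top {A : AddSubgroup ((Fin δ → B) × (Fin δ → B))} {z : B}
    (hspan : AddSubgroup.closure (Set.range fun k : ℕ => z ^ k) = ⊤)
    (h1 : ∀ i k, ((Pi.single i (z ^ k) : Fin δ → B), (0 : Fin δ → B)) ∈ A)
    (h2 : ∀ v, (v, 0) ∈ A → (0, v) ∈ A) : A = ⊤ := by
  have e1 : A.comap (AddMonoidHom.inl _ _) = ⊤ := by
    refine addSubgroup_eq_top_of_pi_single_mem _ fun i x => ?_
    suffices h : (A.comap (AddMonoidHom.inl (Fin δ → B) (Fin δ → B))).comap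
        (AddMonoidHom.single (fun _ => B) i) = ⊤ from
      (h ▸ AddSubgroup.mem_top x : x ∈ (A.comap (AddMonoidHom.inl (Fin δ → B) (Fin δ → B))).comap
        (AddMonoidHom.single (fun _ => B) i))
    rw [eq_top_iff, ← hspan, AddSubgroup.closure_le]
    rintro _ ⟨k, rfl⟩
    exact h1 i k
  rw [eq_top_iff]
  rintro v -
  have m1 : (v.1, (0 : Fin δ → B)) ∈ A :=
    (e1 ▸ AddSubgroup.mem_top v.1 : v.1 ∈ A.comap (AddMonoidHom.inl _ _))
  have m2 : ((0 : Fin δ → B), v.2) ∈ A := h2 _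
    (e1 ▸ AddSubgroup.mem_top v.2 : v.2 ∈ A.comap (AddMonoidHom.inl _ _))
  simpa using A.add_mem m1 m2

theorem reflectAut_ofFiber (h2 : ∀ x : B, x + x = 0) (σ : B →+* B) (z : Bˣ)
    (hσz : σ z = (z⁻¹ : Bˣ)) (w : Multiplicative (Fin δ → Fin δ → B)) :
    reflectAut h2 σ z hσz δ (BilinExt.ofFiber _ w) = BilinExt.ofFiber _ w := by
  have h0 : diagForm (0 : (Fin δ → B) × (Fin δ → B)) = 0 := by
    funext i j
    simp [diagForm]
  ext : 1
  · exact (reflect δ z).map_zero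
  · change w.toAdd + diagForm 0 = w.toAdd
    rw [h0, add_zero]

end DihedralTower

/-! ### The group generated by δ + 2 involutions -/

open DihedralTower in
/-- For every `n ≤ 2 ^ s` there is a `2`-group generated by `δ + 2` elements of order at most two
which has order `2 ^ (2 * n * δ + s + 1)` modulo a central elementary abelian subgroup of
order `2 ^ (n * δ ^ 2)`. -/
theorem exists_involution_tower (δ : ℕ) {n s : ℕ} (hn : n ≤ 2 ^ s) :
    ∃ (Γ : Type) (_ : Group Γ) (_ : Finite Γ) (g : Fin (δ + 2) → Γ) (Z : Subgroup Γ),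
      (∀ i, g i * g i = 1) ∧ Subgroup.closure (Set.range g) = ⊤ ∧ Z ≤ Subgroup.center Γ ∧
      (∀ x ∈ Z, x * x = 1) ∧ Nat.card Z = 2 ^ (n * δ ^ 2) ∧
      Z.index = 2 ^ (2 * n * δ + s + 1) ∧ ∀ x : Γ, x ^ (2 ^ (s + 3)) = 1 := by
  obtain ⟨B, _, _, z, σ, hcard, h2, hzq, hσz, hspan⟩ := exists_unipotent_ring hn
  have h1 : σ (1 : Bˣ) = ((1 : Bˣ)⁻¹ : Bˣ) := by simp
  let f := cocycle δ σ
  let T₁ := reflectAut h2 σ 1 h1 δ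
  let T₂ := reflectAut h2 σ z hσz δ
  have hT : (T₁ * T₂) ^ (2 ^ s) = 1 := by
    ext x : 1
    rw [reflectAut_one_mul_pow, hzq]
    ext <;> simp
  let φ : DihedralGroup (2 ^ s) →* MulAut (BilinExt f) :=
    dihedralLift T₁ T₂ (reflectAut_mul_self h2 σ 1 h1) (reflectAut_mul_self h2 σ z hσz) hT
  let Γ := BilinExt f ⋊[φ] DihedralGroup (2 ^ s)
  have hφ0 : φ (.sr 0) = T₁ := dihedralLift_sr_zero ..
  have hφ1 : φ (.sr 1) = T₂ := dihedralLift_sr_one ..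
  have hφr : φ (.r 1) = T₁ * T₂ := dihedralLift_r_one ..
  let t : Fin δ → BilinExt f := fun i => ⟨(Pi.single i 1, 0), 0⟩
  let g : Fin (δ + 2) → Γ := Fin.cons (SemidirectProduct.inr (.sr 0))
    (Fin.cons (SemidirectProduct.inr (.sr 1)) fun i => SemidirectProduct.inl (t i))
  have hforall : ∀ p : Γ → Prop, p (SemidirectProduct.inr (.sr 0)) →
      p (SemidirectProduct.inr (.sr 1)) → (∀ i, p (SemidirectProduct.inl (t i))) →
      ∀ i, p (g i) := by
    intro p h0 h1 ht i
    refine Fin.cases h0 (fun i => Fin.cases h1 (fun i => ht i) i) i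
  have hV2 : ∀ v : (Fin δ → B) × (Fin δ → B), v + v = 0 := fun v => by ext <;> simp [h2]
  have hZ2 : ∀ w : Fin δ → Fin δ → B, w + w = 0 := fun w => by funext; simp [h2]
  have hfib : Function.Injective (SemidirectProduct.inl.comp (BilinExt.ofFiber f) :
      Multiplicative (Fin δ → Fin δ → B) →* Γ) := by
    refine SemidirectProduct.inl_injective.comp fun x y hxy => ?_
    exact congrArg BilinExt.fiber hxy
  have hclosure : Subgroup.closure (Set.range g) = ⊤ := by
    set C := Subgroup.closure (Set.range g)
    have hmem : ∀ i, g i ∈ C := fun i => Subgroup.subset_closure ⟨i, rfl⟩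
    have hinr : ∀ a, (SemidirectProduct.inr a : Γ) ∈ C := by
      intro a
      have ha : a ∈ Subgroup.closure {(.sr 0 : DihedralGroup (2 ^ s)), .sr 1} := by
        rw [DihedralGroup.closure_sr]; trivial
      have hle : Subgroup.closure {(.sr 0 : DihedralGroup (2 ^ s)), .sr 1} ≤
          C.comap SemidirectProduct.inr := by
        rw [Subgroup.closure_le]
        rintro b (rfl | rfl)
        · exact hmem 0
        · exact hmem 1
      exact hle ha
    have hconj : ∀ (a) (x : BilinExt f), (SemidirectProduct.inl x : Γ) ∈ C →
        (SemidirectProduct.inl (φ a x) : Γ) ∈ C := by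
      intro a x hx
      rw [SemidirectProduct.inl_aut]
      exact mul_mem (mul_mem (hinr _) hx) (hinr _)
    have hbase : BilinExt.baseSubgroup (C.comap SemidirectProduct.inl) = ⊤ := by
      refine prod_eq_top hspan (fun i k => ?_) ?_
      · have h := hconj ((.r 1) ^ k) (t i) (hmem i.succ.succ)
        rw [map_pow, hφr, reflectAut_one_mul_pow] at h
        refine ⟨_, h, ?_⟩
        ext l
        · by_cases hl : l = i
          · subst hl; simp [t]
          · simp [t, hl]
        · simp [t]
      · rintro v ⟨x, hx, hxv⟩
        have h := hconj (.sr 0) _ hx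
        rw [hφ0] at h
        refine ⟨_, h, ?_⟩
        rw [reflectAut_base, hxv]
        ext <;> simp [reflect]
    have htop : C.comap SemidirectProduct.inl = ⊤ :=
      BilinExt.eq_top_of_subgroups hbase (fiberSubgroup_eq_top σ hbase)
    rw [eq_top_iff]
    rintro x -
    rw [← SemidirectProduct.inl_left_mul_inr_right x]
    have hx : x.left ∈ C.comap SemidirectProduct.inl := htop ▸ Subgroup.mem_top _
    exact mul_mem hx (hinr _)
  have hZcard : Nat.card (SemidirectProduct.inl.comp (BilinExt.ofFiber f) :
      Multiplicative (Fin δ → Fin δ → B) →* Γ).range = 2 ^ (n * δ ^ 2) := by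
    rw [← Nat.card_congr (MonoidHom.ofInjective hfib).toEquiv, Nat.card_congr Multiplicative.toAdd]
    simp only [Nat.card_fun, Nat.card_fin, hcard]
    rw [← pow_mul, ← pow_mul]
    congr 1; ring
  refine ⟨Γ, inferInstance, Finite.of_equiv _ SemidirectProduct.equivProd.symm, g,
    (SemidirectProduct.inl.comp (BilinExt.ofFiber f)).range,
    ?_, hclosure, ?_, ?_, hZcard, ?_, ?_⟩
  · refine hforall (fun x => x * x = 1) ?_ ?_ fun i => ?_
    · rw [← map_mul, DihedralGroup.sr_mul_self, map_one]
    · rw [← map_mul, DihedralGroup.sr_mul_self, map_one]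
    · rw [← map_mul]
      have : t i * t i = 1 := by
        ext k l
        · simp [t, h2]
        · simp [t]
        · simp only [t, BilinExt.mul_fiber, f, cocycle_apply, BilinExt.one_fiber, Pi.add_apply,
            Pi.zero_apply, Pi.single_apply]
          split_ifs <;> simp_all
      rw [this, map_one]
  · rintro _ ⟨w, rfl⟩
    rw [Subgroup.mem_center_iff]
    intro x
    have hx : x ∈ Subgroup.closure (Set.range g) := by rw [hclosure]; trivial
    suffices h : Subgroup.closure (Set.range g) ≤ Subgroup.centralizer
        {SemidirectProduct.inl (BilinExt.ofFiber f w)} from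
      (Subgroup.mem_centralizer_singleton_iff.1 (h hx))
    rw [Subgroup.closure_le, Set.range_subset_iff]
    have hfix : ∀ a : DihedralGroup (2 ^ s), φ a (BilinExt.ofFiber f w) = BilinExt.ofFiber f w →
        (SemidirectProduct.inr a : Γ) ∈ (Subgroup.centralizer
          {(SemidirectProduct.inl (BilinExt.ofFiber f w) : Γ)} : Set Γ) := by
      intro a ha
      refine Subgroup.mem_centralizer_singleton_iff.2 ?_
      nth_rewrite 2 [← ha]
      rw [SemidirectProduct.inl_aut]
      simp
    refine hforall _ (hfix _ ?_) (hfix _ ?_) fun i => ?_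
    · rw [hφ0]; exact reflectAut_ofFiber ..
    · rw [hφ1]; exact reflectAut_ofFiber ..
    · refine Subgroup.mem_centralizer_singleton_iff.2 ?_
      rw [← map_mul, ← map_mul]
      congr 1
      ext <;> simp [BilinExt.ofFiber, add_comm]
  · rintro _ ⟨w, rfl⟩
    rw [← map_mul]
    have : w * w = 1 := Multiplicative.toAdd.injective (hZ2 w.toAdd)
    rw [this, map_one]
  · have hΓ : Nat.card Γ = 2 ^ (2 * n * δ + s + 1) * 2 ^ (n * δ ^ 2) := by
      rw [SemidirectProduct.card, BilinExt.natCard, DihedralGroup.nat_card, Nat.card_prod]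
      simp only [Nat.card_fun, Nat.card_fin, hcard]
      ring
    have := Subgroup.index_mul_card (SemidirectProduct.inl.comp (BilinExt.ofFiber f) :
      Multiplicative (Fin δ → Fin δ → B) →* Γ).range
    rw [hΓ, hZcard] at this
    exact Nat.eq_of_mul_eq_mul_right (by positivity) this
  · intro x
    -- The dihedral quotient has order 2^(s+1) and the kernel has exponent dividing 4, whence s + 3.
    have hx : SemidirectProduct.rightHom (x ^ (2 ^ (s + 1))) = 1 := by
      rw [map_pow, pow_succ', ← DihedralGroup.nat_card]
      exact pow_card_eq_one'
    have hx' : x ^ (2 ^ (s + 1)) ∈ (SemidirectProduct.inl : BilinExt f →* Γ).range := by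
      rw [SemidirectProduct.range_inl_eq_ker_rightHom]
      exact hx
    obtain ⟨y, hy⟩ := hx'
    rw [show s + 3 = (s + 1) + 2 from rfl, pow_add 2 (s + 1) 2, pow_mul, ← hy, ← map_pow,
      show 2 ^ 2 = 4 from rfl, BilinExt.pow_four hV2 hZ2, map_one]

/-! ### Self-normalizing regular subgroups and Cayley graphs -/

/-- A finite p-group is nilpotent, so its proper subgroups are strictly smaller than their
normalizers in it. -/
theorem IsPGroup.eq_of_le_of_normalizer_eq {p : ℕ} [Fact p.Prime] {A : Type*} [Group A] [Finite A]
    {R P : Subgroup A} (hP : IsPGroup p P) (hle : R ≤ P)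
    (hnorm : Subgroup.normalizer (R : Set A) = R) : R = P := by
  have : Group.IsNilpotent P := hP.isNilpotent
  have hcond := Group.normalizerCondition_of_isNilpotent (G := P)
  rw [normalizerCondition_iff_only_full_group_self_normalizing] at hcond
  refine le_antisymm hle (Subgroup.subgroupOf_eq_top.1 (hcond _ (le_antisymm ?_
    Subgroup.le_normalizer)))
  intro x hx
  rw [Subgroup.mem_normalizer_iff] at hx
  rw [Subgroup.mem_subgroupOf, ← hnorm, Subgroup.mem_normalizer_iff]
  have hfwd : ∀ y ∈ R, (x : A) * y * (x : A)⁻¹ ∈ R := fun y hy =>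
    (hx ⟨y, hle hy⟩).1 hy
  refine fun y => ⟨hfwd y, fun h => ?_⟩
  have hyP : y ∈ P := by
    have := P.mul_mem (P.mul_mem (P.inv_mem x.2) (hle h)) x.2
    simpa [mul_assoc] using this
  exact (hx ⟨y, hyP⟩).2 h

/-- Self-normalizing `p`-subgroups of a finite group are isomorphic, being Sylow subgroups. -/
theorem IsPGroup.nonempty_mulEquiv_of_normalizer_eq {p : ℕ} [Fact p.Prime] {A : Type*} [Group A]
    [Finite A] {R R' : Subgroup A} (hR : IsPGroup p R) (hR' : IsPGroup p R')
    (h : Subgroup.normalizer (R : Set A) = R) (h' : Subgroup.normalizer (R' : Set A) = R') :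
    Nonempty (R ≃* R') := by
  obtain ⟨P, hP⟩ := hR.exists_le_sylow
  obtain ⟨P', hP'⟩ := hR'.exists_le_sylow
  rw [P.2.eq_of_le_of_normalizer_eq hP h, P'.2.eq_of_le_of_normalizer_eq hP' h']
  exact ⟨Sylow.equiv P P'⟩

theorem cayleyRegularRep_injective {G : Type*} [Group G] (S : Set G) :
    Function.Injective (cayleyRegularRep S) := by
  intro g h hgh
  have := DFunLike.congr_fun hgh (1 : G)
  simpa [cayleyRegularRep] using this

theorem cayleyRegularRep_apply {G : Type*} [Group G] (S : Set G) (g u : G) :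
    cayleyRegularRep S g u = u * g⁻¹ := rfl

/-- Conjugation by a graph isomorphism. -/
def SimpleGraph.Iso.autCongr {V V' : Type*} {Γ : SimpleGraph V} {Γ' : SimpleGraph V'}
    (e : Γ ≃g Γ') : (Γ ≃g Γ) ≃* (Γ' ≃g Γ') where
  toFun φ := (e.symm.trans φ).trans e
  invFun φ := (e.trans φ).trans e.symm
  left_inv φ := by ext; simp
  right_inv φ := by ext; simp
  map_mul' φ ψ := by ext; simp [RelIso.mul_apply]

/-- A Cayley graph of a `p`-group `G` in which `G` is self-normalizing determines `G`. -/
theorem IsSelfNormalizingCayley.nonempty_mulEquiv {p : ℕ} [Fact p.Prime] {G H : Type*} [Group G]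
    [Group H] [Finite G] (hG : IsPGroup p G) (hH : IsPGroup p H) {S : Set G} {T : Set H}
    (hS : IsSelfNormalizingCayley S) (hT : IsSelfNormalizingCayley T)
    (e : cayleyGraph S ≃g cayleyGraph T) : Nonempty (G ≃* H) := by
  have : Finite (cayleyGraph S ≃g cayleyGraph S) := DFunLike.finite _
  let ρ : H →* (cayleyGraph S ≃g cayleyGraph S) :=
    e.autCongr.symm.toMonoidHom.comp (cayleyRegularRep T)
  have hρ : Function.Injective ρ := e.autCongr.symm.injective.comp (cayleyRegularRep_injective T)
  have hrange : ρ.range = (cayleyRegularRep T).range.map e.autCongr.symm.toMonoidHom :=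
    MonoidHom.range_comp _ _
  have hnorm : Subgroup.normalizer (ρ.range : Set (cayleyGraph S ≃g cayleyGraph S)) = ρ.range := by
    have hmap := Subgroup.map_equiv_normalizer_eq (cayleyRegularRep T).range e.autCongr.symm
    rw [hrange, ← hmap]
    exact congrArg _ hT
  have hGr := hG.of_equiv (MonoidHom.ofInjective (cayleyRegularRep_injective S))
  have hHr := hH.of_equiv (MonoidHom.ofInjective hρ)
  obtain ⟨ε⟩ := hGr.nonempty_mulEquiv_of_normalizer_eq hHr hS hnorm
  exact ⟨(MonoidHom.ofInjective (cayleyRegularRep_injective S)).trans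
    (ε.trans (MonoidHom.ofInjective hρ).symm)⟩

/-- If no nontrivial automorphism of `G` preserves `S`, then `G` is self-normalizing in the
automorphism group of its Cayley graph. -/
theorem isSelfNormalizingCayley_of_rigid {G : Type*} [Group G] {S : Set G}
    (hinv : ∀ s ∈ S, s⁻¹ ∈ S) (hone : (1 : G) ∉ S)
    (hrigid : ∀ α : G ≃* G, (∀ g, α g ∈ S ↔ g ∈ S) → ∀ g, α g = g) :
    IsSelfNormalizingCayley S := by
  refine le_antisymm ?_ Subgroup.le_normalizer
  intro φ hφ
  have hφ' := Subgroup.mem_normalizer_iff.1 hφ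
  -- φ conjugates right translations to right translations; the new translation is read off at u =
  -- 1. So φ followed by right multiplication by (φ 1)⁻¹ is a group automorphism.
  have hmul : ∀ u g, φ (u * g) = φ u * ((φ 1)⁻¹ * φ g) := by
    intro u g
    obtain ⟨c, hc⟩ := (hφ' (cayleyRegularRep S g⁻¹)).1 ⟨_, rfl⟩
    have h : ∀ v, φ (v * g) = φ v * c⁻¹ := by
      intro v
      have := DFunLike.congr_fun hc (φ v)
      rw [cayleyRegularRep_apply, RelIso.mul_apply, RelIso.mul_apply, RelIso.inv_apply_self,
        cayleyRegularRep_apply, inv_inv] at this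
      exact this.symm
    have h1 := h 1
    rw [one_mul] at h1
    rw [h u, h1, inv_mul_cancel_left]
  let α : G ≃* G :=
    { toEquiv := φ.toEquiv.trans (Equiv.mulRight (φ 1)⁻¹)
      map_mul' := fun u g => by
        change φ (u * g) * (φ 1)⁻¹ = φ u * (φ 1)⁻¹ * (φ g * (φ 1)⁻¹)
        rw [hmul]
        group }
  have hα : ∀ g, α g = φ g * (φ 1)⁻¹ := fun g => rfl
  have hαS : ∀ g, α g ∈ S ↔ g ∈ S := by
    intro g
    rw [hα, ← cayleyGraph_adj hinv hone, φ.map_adj_iff, cayleyGraph_adj hinv hone, inv_one,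
      mul_one]
  refine ⟨(φ 1)⁻¹, ?_⟩
  ext g
  have := hrigid α hαS g
  rw [hα, mul_inv_eq_iff_eq_mul] at this
  rw [cayleyRegularRep_apply, inv_inv, this]

/-- The isomorphism classes of groups of order `2 ^ m` that are self-normalizing in the
automorphism group of the Cayley graph of some generating set of `d` involutions. -/
def selfNormalizingClasses (d m : ℕ) :
    Set (Quotient (CategoryTheory.isIsomorphicSetoid GrpCat.{0})) :=
  {c | ∃ G : GrpCat.{0}, Quotient.mk _ G = c ∧ Nat.card G = 2 ^ m ∧
    ∃ S : Set G, IsInvolutionGeneratingSet d S ∧ IsSelfNormalizingCayley S}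

theorem selfNormalizingClasses_subset (d m : ℕ) :
    selfNormalizingClasses d m ⊆ involutionGroupClasses d m := by
  rintro c ⟨G, hG, hcard, S, hS, -⟩
  exact ⟨G, hG, hcard, S, hS⟩

theorem ncard_selfNormalizingClasses_le_groups (d m : ℕ) :
    (selfNormalizingClasses d m).ncard ≤ numInvolutionGroups d m :=
  Set.ncard_le_ncard (selfNormalizingClasses_subset d m) (involutionGroupClasses_finite d m)

/-- Choosing one graph for each class is injective: an isomorphism of graphs puts both groups into
one automorphism group as Sylow 2-subgroups. -/
theorem ncard_selfNormalizingClasses_le_graphs (d m : ℕ) :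
    (selfNormalizingClasses d m).ncard ≤ numSelfNormalizingCayleyGraphs d m := by
  have hex : ∀ c ∈ selfNormalizingClasses d m, ∃ (G : GrpCat.{0}) (S : Set G)
      (Δ : SimpleGraph (Fin (2 ^ m))), Quotient.mk _ G = c ∧ Nat.card G = 2 ^ m ∧
      IsInvolutionGeneratingSet d S ∧ IsSelfNormalizingCayley S ∧
      Nonempty (Δ ≃g cayleyGraph S) := by
    rintro c ⟨G, hG, hcard, S, hS, hSn⟩
    have hfin : Finite G := Nat.finite_of_card_ne_zero (by rw [hcard]; positivity)
    let e : Fin (2 ^ m) ≃ G := (Finite.equivFinOfCardEq hcard).symm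
    exact ⟨G, S, (cayleyGraph S).comap e, hG, hcard, hS, hSn,
      ⟨SimpleGraph.Iso.comap e (cayleyGraph S)⟩⟩
  choose! G S Δ hG hcard hS hSn hΔ using hex
  have : Finite (Quotient (graphIsoSetoid (2 ^ m))) := Quotient.finite _
  refine Set.ncard_le_ncard_of_injOn (fun c => Quotient.mk (graphIsoSetoid (2 ^ m)) (Δ c))
    (fun c hc => ⟨Δ c, rfl, G c, inferInstance, S c, hS c hc, hSn c hc, hΔ c hc⟩) ?_
    (Set.toFinite _)
  intro c hc c' hc' hcc
  obtain ⟨e⟩ : Nonempty (Δ c ≃g Δ c') := Quotient.exact hcc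
  obtain ⟨e₁⟩ := hΔ c hc
  obtain ⟨e₂⟩ := hΔ c' hc'
  have hfin : Finite (G c) := Nat.finite_of_card_ne_zero (by rw [hcard c hc]; positivity)
  obtain ⟨ε⟩ := (hSn c hc).nonempty_mulEquiv (p := 2) (IsPGroup.of_card (hcard c hc))
    (IsPGroup.of_card (hcard c' hc')) (hSn c' hc') ((e₁.symm.trans e).trans e₂)
  rw [← hG c hc, ← hG c' hc']
  exact Quotient.sound ⟨MulEquiv.toGrpIso ε⟩

/-! ### Counting quotients up to isomorphism -/

/-- Distinct normal subgroups of a `d`-generated group give few isomorphic quotients. -/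
theorem natCard_le_mul_ncard_of_quotients {d m : ℕ} {H : Type} [Group H] {s : Fin d → H}
    (hs : Subgroup.closure (Set.range s) = ⊤) {ι : Type} [Finite ι] (F : ι → Subgroup H)
    (hF : Function.Injective F) [hN : ∀ i, (F i).Normal] (hcard : ∀ i, Nat.card (H ⧸ F i) = 2 ^ m)
    {C : Set (Quotient (CategoryTheory.isIsomorphicSetoid GrpCat.{0}))} (hCfin : C.Finite)
    (hC : ∀ i, Quotient.mk _ (GrpCat.of (H ⧸ F i)) ∈ C) :
    Nat.card ι ≤ 2 ^ (m * d) * C.ncard := by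
  classical
  cases nonempty_fintype ι
  let cl : ι → Quotient (CategoryTheory.isIsomorphicSetoid GrpCat.{0}) :=
    fun i => Quotient.mk _ (GrpCat.of (H ⧸ F i))
  have hfiber : ∀ c ∈ Finset.univ.image cl,
      (Finset.univ.filter fun i => cl i = c).card ≤ 2 ^ (m * d) := by
    intro c hc
    obtain ⟨i₀, -, hi₀⟩ := Finset.mem_image.1 hc
    have hiso : ∀ i : {i // cl i = c}, Nonempty (H ⧸ F i ≃* H ⧸ F i₀) := by
      rintro ⟨i, hi⟩
      obtain ⟨e⟩ := Quotient.exact (hi.trans hi₀.symm)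
      exact ⟨e.groupIsoToMulEquiv⟩
    have e := fun i => (hiso i).some
    let ψ : ∀ i : {i // cl i = c}, H →* H ⧸ F i₀ := fun i =>
      (e i).toMonoidHom.comp (QuotientGroup.mk' (F i))
    have hker : ∀ i, (ψ i).ker = F i := by
      intro i
      ext x
      simp [ψ]
    -- F i is recovered as the kernel of ψ i, and ψ i from its values on the d generators: at most
    -- (2^m)^d choices.
    have hinj : Function.Injective fun (i : {i // cl i = c}) (k : Fin d) => ψ i (s k) := by
      intro i j hij
      have hψ : ψ i = ψ j := MonoidHom.eq_of_eqOn_dense hs (by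
        rintro _ ⟨k, rfl⟩
        exact congrFun hij k)
      exact Subtype.ext (hF (by rw [← hker, ← hker, hψ]))
    have hfinq : Finite (H ⧸ F i₀) :=
      Nat.finite_of_card_ne_zero (by rw [hcard]; positivity)
    have hle := Nat.card_le_card_of_injective _ hinj
    rw [Nat.card_fun, hcard, Nat.card_fin, ← pow_mul] at hle
    rwa [← Fintype.card_subtype, ← Nat.card_eq_fintype_card]
  have himage : (Finset.univ.image cl).card ≤ C.ncard := by
    rw [← Set.ncard_coe_finset]
    refine Set.ncard_le_ncard ?_ hCfin
    intro c hc
    obtain ⟨i, -, rfl⟩ := Finset.mem_image.1 (Finset.mem_coe.1 hc)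
    exact hC i
  rw [Nat.card_eq_fintype_card]
  exact (Finset.card_le_mul_card_image _ _ hfiber).trans (Nat.mul_le_mul_left _ himage)

/-! ### Rigid generating sets -/

/-- Involutions with pairwise different orders of products form a rigid generating set. -/
theorem isSelfNormalizingCayley_range_of_orders {d : ℕ} (hd : 3 ≤ d) {G : Type*} [Group G]
    {s : Fin d → G} (hs : ∀ i, orderOf (s i) = 2) (hcl : Subgroup.closure (Set.range s) = ⊤)
    (hord : ∀ i j k l, i ≠ j → k ≠ l → orderOf (s i * s j) = orderOf (s k * s l) →
      (i = k ∧ j = l) ∨ (i = l ∧ j = k)) (hinj : Function.Injective s) :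
    IsInvolutionGeneratingSet d (Set.range s) ∧ IsSelfNormalizingCayley (Set.range s) := by
  refine ⟨⟨Set.finite_range s, ?_, ?_, hcl⟩, isSelfNormalizingCayley_of_rigid ?_ ?_ ?_⟩
  · rw [← Set.image_univ, Set.ncard_image_of_injective _ hinj, Set.ncard_univ, Nat.card_fin]
  · rintro _ ⟨i, rfl⟩
    exact hs i
  · rintro _ ⟨i, rfl⟩
    refine ⟨i, eq_inv_of_mul_eq_one_left ?_⟩
    rw [← pow_two, ← hs i, pow_orderOf_eq_one]
  · rintro ⟨i, hi⟩
    have := hs i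
    rw [hi, orderOf_one] at this
    omega
  · intro α hα
    have hex : ∀ i, ∃ j, s j = α (s i) := fun i => (hα (s i)).2 ⟨i, rfl⟩
    choose π hπ using hex
    have hπinj : Function.Injective π := by
      intro i j hij
      exact hinj (α.injective (by rw [← hπ, ← hπ, hij]))
    have hpair : ∀ i j, i ≠ j → (π i = i ∨ π i = j) := by
      intro i j hij
      have horder : orderOf (s (π i) * s (π j)) = orderOf (s i * s j) := by
        rw [hπ, hπ, ← map_mul]
        exact orderOf_injective α.toMonoidHom α.injective _
      rcases hord _ _ _ _ (hπinj.ne hij) hij horder with h | h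
      · exact Or.inl h.1
      · exact Or.inr h.1
    -- Each pair {i, j} is preserved by π. As d ≥ 3, two such pairs meet exactly in i, which is
    -- therefore fixed.
    have hfix : ∀ i, π i = i := by
      intro i
      have hcard : 2 < (Finset.univ : Finset (Fin d)).card := by
        rw [Finset.card_univ, Fintype.card_fin]; omega
      have h1 : 1 < ((Finset.univ : Finset (Fin d)).erase i).card := by
        rw [Finset.card_erase_of_mem (Finset.mem_univ i)]; omega
      obtain ⟨j, hj, k, hk, hjk⟩ := Finset.one_lt_card.1 h1
      rcases hpair i j (Finset.ne_of_mem_erase hj).symm with h | h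
      · exact h
      rcases hpair i k (Finset.ne_of_mem_erase hk).symm with h' | h'
      · exact h'
      · exact absurd (h.symm.trans h') hjk
    have heq : α.toMonoidHom = MonoidHom.id G := MonoidHom.eq_of_eqOn_dense hcl (by
      rintro _ ⟨i, rfl⟩
      change α (s i) = s i
      rw [← hπ, hfix])
    exact fun g => DFunLike.congr_fun heq g

/-- Involutions of a product of dihedral groups all of whose products of pairs have large and
different orders. -/
theorem exists_involutions_with_distinct_orders {d : ℕ} (hd : 2 ≤ d) (a : ℕ) :
    ∃ (M : Type) (_ : Group M) (_ : Finite M) (g : Fin d → M) (μ : ℕ),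
      Nat.card M = 2 ^ μ ∧ μ ≤ d ^ 2 * (a + 2 + d ^ 2) ∧ (∀ i, orderOf (g i) = 2) ∧
      (∀ i j, i ≠ j → 2 ^ (a + 1) ∣ orderOf (g i * g j)) ∧
      ∀ i j k l, i ≠ j → k ≠ l → orderOf (g i * g j) = orderOf (g k * g l) →
        (i = k ∧ j = l) ∨ (i = l ∧ j = k) := by
  -- The base-d number with digits p.1, p.2 makes the exponents distinct; the offset a + 1 makes
  -- every order a multiple of 2^(a+1).
  let w : Fin d × Fin d → ℕ := fun p => a + 1 + (p.1 * d + p.2)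
  let M := ∀ p : Fin d × Fin d, DihedralGroup (2 ^ w p)
  let g : Fin d → M := fun l p =>
    if p.1 < p.2 then if l = p.1 then .sr 0 else if l = p.2 then .sr 1 else 1 else 1
  have hwlt : ∀ p, w p + 1 ≤ a + 2 + d ^ 2 := by
    intro p
    have h1 := p.1.2
    have h2 := p.2.2
    have h3 : (p.1 : ℕ) * d + d ≤ d ^ 2 := by nlinarith
    simp only [w]
    omega
  have hg : ∀ l p, g l p =
      if p.1 < p.2 then if l = p.1 then .sr 0 else if l = p.2 then .sr 1 else 1 else 1 :=
    fun _ _ => rfl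
  have hmul : ∀ (x y : M) p, (x * y) p = x p * y p := fun _ _ _ => rfl
  have hsq : ∀ l, g l * g l = 1 := by
    intro l
    funext p
    rw [hmul, hg]
    split_ifs <;> simp only [DihedralGroup.sr_mul_self, mul_one] <;> rfl
  have hval : ∀ i j, i < j → (g i * g j) (i, j) = .r 1 := by
    intro i j hij
    rw [hmul, hg, hg]
    simp [hij, hij.ne']
  have horder : ∀ i j, i < j → orderOf (g i * g j) = 2 ^ w (i, j) := by
    intro i j hij
    refine Nat.dvd_antisymm (orderOf_dvd_of_pow_eq_one ?_) ?_
    · funext p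
      rw [Pi.pow_apply, Pi.one_apply]
      by_cases hp : p = (i, j)
      · subst hp
        rw [hval i j hij]
        exact DihedralGroup.r_one_pow_n
      -- Only the coordinate (i, j) sees both involutions; elsewhere the product squares to 1.
      · have hor : g i p = 1 ∨ g j p = 1 := by
          by_contra! hne
          rw [hg, hg] at hne
          apply hp
          ext <;> grind
        have hc : (g i * g j) p ^ 2 = 1 := by
          have hi : g i p * g i p = 1 := congrFun (hsq i) p
          have hj : g j p * g j p = 1 := congrFun (hsq j) p
          rw [hmul, pow_two]
          rcases hor with h | h
          · rw [h, one_mul, hj]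
          · rw [h, mul_one, hi]
        obtain ⟨c, hcw⟩ : 2 ∣ 2 ^ w (i, j) := dvd_pow_self 2 (by simp only [w]; omega)
        rw [hcw, pow_mul, hc, one_pow]
    · have := orderOf_map_dvd (Pi.evalMonoidHom (fun p => DihedralGroup (2 ^ w p)) (i, j))
        (g i * g j)
      rwa [Pi.evalMonoidHom_apply, hval i j hij, DihedralGroup.orderOf_r_one] at this
  have hsymm : ∀ i j, orderOf (g j * g i) = orderOf (g i * g j) := by
    intro i j
    rw [← orderOf_inv, mul_inv_rev, inv_eq_of_mul_eq_one_left (hsq i),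
      inv_eq_of_mul_eq_one_left (hsq j)]
  have hdistinct : ∀ i j k l : Fin d, i < j → k < l →
      orderOf (g i * g j) = orderOf (g k * g l) → i = k ∧ j = l := by
    intro i j k l hij hkl h
    rw [horder _ _ hij, horder _ _ hkl] at h
    have hw : w (i, j) = w (k, l) := Nat.pow_right_injective le_rfl h
    have hw' : (j : ℕ) + i * d = l + k * d := by simp only [w] at hw; omega
    have hdpos : 0 < d := by omega
    have hdiv := congrArg (· / d) hw'
    have hmod := congrArg (· % d) hw'
    simp only [Nat.add_mul_div_right _ _ hdpos, Nat.div_eq_of_lt j.2, Nat.div_eq_of_lt l.2,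
      Nat.add_mul_mod_self_right, Nat.mod_eq_of_lt j.2, Nat.mod_eq_of_lt l.2, zero_add] at hdiv hmod
    exact ⟨Fin.ext hdiv, Fin.ext hmod⟩
  have hsr : ∀ (q : ℕ) (c : ZMod q), (.sr c : DihedralGroup q) ≠ 1 := by
    intro q c hc
    rw [DihedralGroup.one_def] at hc
    cases hc
  have hne : ∀ i, g i ≠ 1 := by
    intro i hi
    obtain ⟨j, hj⟩ : ∃ j : Fin d, j ≠ i := by
      have : Nontrivial (Fin d) := Fin.nontrivial_iff_two_le.2 hd
      exact exists_ne i
    rcases hj.lt_or_gt with h | h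
    · have := congrFun hi (j, i)
      rw [hg, Pi.one_apply] at this
      simp only [h, h.ne', if_true, if_false] at this
      exact hsr _ _ this
    · have := congrFun hi (i, j)
      rw [hg, Pi.one_apply] at this
      simp only [h, if_true] at this
      exact hsr _ _ this
  have : ∀ p, NeZero (2 ^ w p) := fun p => ⟨by positivity⟩
  have hfin : ∀ p, Finite (DihedralGroup (2 ^ w p)) := fun p => inferInstance
  refine ⟨M, inferInstance, inferInstance, g, ∑ p, (w p + 1), ?_, ?_, ?_, ?_, ?_⟩
  · rw [Nat.card_pi, ← Finset.prod_pow_eq_pow_sum]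
    refine Finset.prod_congr rfl fun p _ => ?_
    rw [DihedralGroup.nat_card, pow_succ']
  · refine (Finset.sum_le_sum fun p _ => hwlt p).trans ?_
    simp [pow_two, Fintype.card_prod]
  · intro i
    exact orderOf_eq_prime (by rw [pow_two, hsq]) (hne i)
  · intro i j hij
    have hdvd : ∀ i j : Fin d, i < j → 2 ^ (a + 1) ∣ orderOf (g i * g j) := by
      intro i j h
      rw [horder _ _ h]
      exact pow_dvd_pow 2 (Nat.le_add_right _ _)
    rcases hij.lt_or_gt with h | h
    · exact hdvd _ _ h
    · rw [hsymm]; exact hdvd _ _ h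
  · intro i j k l hij hkl h
    rcases hij.lt_or_gt with h1 | h1 <;> rcases hkl.lt_or_gt with h2 | h2
    · exact Or.inl (hdistinct _ _ _ _ h1 h2 h)
    · rw [hsymm l k] at h
      exact Or.inr (hdistinct _ _ _ _ h1 h2 h)
    · rw [hsymm j i] at h
      exact Or.inr (hdistinct _ _ _ _ h1 h2 h).symm
    · rw [hsymm j i, hsymm l k] at h
      exact Or.inl (hdistinct _ _ _ _ h1 h2 h).symm

/-! ### Many central subgroups and their quotients -/

/-- An elementary abelian `2`-subgroup of rank `t + J` has many subgroups of rank `t`. -/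
theorem exists_subgroup_family {H : Type*} [Group H] {Z : Subgroup H}
    (hcomm : ∀ x ∈ Z, ∀ y ∈ Z, x * y = y * x) (hsq : ∀ x ∈ Z, x * x = 1) {t J : ℕ}
    (hcard : Nat.card Z = 2 ^ (t + J)) :
    ∃ F : ((Fin t → ZMod 2) →ₗ[ZMod 2] (Fin J → ZMod 2)) → Subgroup H,
      Function.Injective F ∧ (∀ T, F T ≤ Z) ∧ ∀ T, Nat.card (F T) = 2 ^ t := by
  let _ : CommGroup Z :=
    { (inferInstance : Group Z) with
      mul_comm := fun x y => Subtype.ext (hcomm x x.2 y y.2) }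
  let _ : Module (ZMod 2) (Additive Z) := AddCommGroup.zmodModule (fun x => by
    rw [two_nsmul]
    exact Additive.toMul.injective (Subtype.ext (hsq _ (Additive.toMul x).2)))
  have hfinZ : Finite Z := Nat.finite_of_card_ne_zero (by rw [hcard]; positivity)
  have hfinA : Finite (Additive Z) := hfinZ
  have : Module.Finite (ZMod 2) (Additive Z) := Module.Finite.of_finite
  have hrank : Module.finrank (ZMod 2) (Additive Z) =
      Module.finrank (ZMod 2) ((Fin t → ZMod 2) × (Fin J → ZMod 2)) := by
    have h := Module.natCard_eq_pow_finrank (K := ZMod 2) (V := Additive Z)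
    rw [Nat.card_zmod, Nat.card_congr Additive.toMul, hcard] at h
    rw [Module.finrank_prod, Module.finrank_fin_fun, Module.finrank_fin_fun]
    exact (Nat.pow_right_injective le_rfl h).symm
  let e := (LinearEquiv.ofFinrankEq _ _ hrank).symm
  -- The subgroups are the graphs of linear maps T in a splitting of Z; a graph determines its map.
  let ψ : ((Fin t → ZMod 2) →ₗ[ZMod 2] (Fin J → ZMod 2)) → (Multiplicative (Fin t → ZMod 2) →* H) :=
    fun T => Z.subtype.comp (AddMonoidHom.toMultiplicativeLeft
      ((e.toLinearMap.comp (LinearMap.id.prod T)).toAddMonoidHom))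
  have hψ : ∀ T v, ψ T v = ((e (v.toAdd, T v.toAdd)).toMul : Z) := fun T v => rfl
  have hψeq : ∀ T T' v v', ψ T v = ψ T' v' → v = v' ∧ T v.toAdd = T' v'.toAdd := by
    intro T T' v v' h
    rw [hψ, hψ] at h
    have := e.injective (Additive.toMul.injective (Subtype.ext h))
    exact Prod.mk.inj this
  refine ⟨fun T => (ψ T).range, ?_, ?_, ?_⟩
  · intro T T' h
    ext1 i
    ext1
    have hmem : ψ T (Multiplicative.ofAdd (Pi.single i 1)) ∈ (ψ T').range := by
      have h' : (ψ T).range = (ψ T').range := h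
      rw [← h']
      exact ⟨_, rfl⟩
    obtain ⟨v, hv⟩ := hmem
    obtain ⟨rfl, h2⟩ := hψeq _ _ _ _ hv
    exact h2.symm
  · rintro T _ ⟨v, rfl⟩
    exact ((e (v.toAdd, T v.toAdd)).toMul : Z).2
  · intro T
    have hinj : Function.Injective (ψ T) := fun v v' h => (hψeq _ _ _ _ h).1
    rw [← Nat.card_congr (MonoidHom.ofInjective hinj).toEquiv, Nat.card_congr Multiplicative.toAdd]
    simp

theorem natCard_linearMap_zmod_two (t J : ℕ) :
    Nat.card ((Fin t → ZMod 2) →ₗ[ZMod 2] (Fin J → ZMod 2)) = 2 ^ (t * J) := by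
  rw [Module.natCard_eq_pow_finrank (K := ZMod 2), Module.finrank_linearMap]
  simp

/-- A central elementary abelian subgroup of large order in a group generated by `d` elements of
order at most two yields many self-normalizing classes. -/
theorem exists_pow_le_ncard_selfNormalizingClasses {d : ℕ} (hd : 3 ≤ d) {Γ : Type} [Group Γ]
    [Finite Γ] {g : Fin d → Γ} {Z : Subgroup Γ} (hg : ∀ i, g i * g i = 1)
    (hcl : Subgroup.closure (Set.range g) = ⊤) (hZc : Z ≤ Subgroup.center Γ)
    (hZ2 : ∀ x ∈ Z, x * x = 1) {k R a : ℕ} (hZcard : Nat.card Z = 2 ^ R)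
    (hZindex : Z.index = 2 ^ k) (hexp : ∀ x : Γ, x ^ 2 ^ a = 1) :
    ∃ x ρ, x ≤ d ^ 2 * (a + 2 + d ^ 2) ∧ R ≤ ρ + x ∧ ∀ t J m, t + J = ρ → k + x + J = m →
      2 ^ (t * J) ≤ 2 ^ (m * d) * (selfNormalizingClasses d m).ncard := by
  obtain ⟨M, _, _, u, μ, hMcard, hμ, hu2, hudvd, huord⟩ :=
    exists_involutions_with_distinct_orders (d := d) (by omega) a
  have huu : ∀ i, u i * u i = 1 := fun i => by
    rw [← pow_two, ← hu2 i, pow_orderOf_eq_one]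
  -- Pairing generators inside Γ × M keeps the large centre of Γ while recording the orders from M.
  let H : Subgroup (Γ × M) := Subgroup.closure (Set.range fun i => (g i, u i))
  let h : Fin d → H := fun i => ⟨(g i, u i), Subgroup.subset_closure ⟨i, rfl⟩⟩
  have hhcl : Subgroup.closure (Set.range h) = ⊤ := by
    have := Subgroup.closure_closure_coe_preimage (k := Set.range fun i => (g i, u i))
    rw [← this]
    congr 1
    ext y
    constructor
    · rintro ⟨i, rfl⟩
      exact ⟨i, rfl⟩
    · rintro ⟨i, hi⟩
      exact ⟨i, Subtype.ext hi⟩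
  let π₁ : H →* Γ := (MonoidHom.fst Γ M).comp H.subtype
  let π₂ : H →* M := (MonoidHom.snd Γ M).comp H.subtype
  have hext : ∀ y z : H, π₁ y = π₁ z → π₂ y = π₂ z → y = z := fun y z h1 h2 =>
    Subtype.ext (Prod.ext h1 h2)
  have hπ₁ : Function.Surjective π₁ := by
    rw [← MonoidHom.range_eq_top, eq_top_iff, ← hcl, Subgroup.closure_le]
    rintro _ ⟨i, rfl⟩
    exact ⟨h i, rfl⟩
  let K := Z.comap π₁
  let Y := π₂.ker ⊓ K
  have hKindex : K.index = 2 ^ k := by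
    rw [← hZindex]
    exact Subgroup.index_comap_of_surjective Z hπ₁
  obtain ⟨x, hx, hxcard⟩ : ∃ x ≤ μ, Nat.card (K.map π₂) = 2 ^ x := by
    refine (Nat.dvd_prime_pow Nat.prime_two).1 ?_
    rw [← hMcard]
    exact Subgroup.card_subgroup_dvd_card _
  have hrel : Y.relIndex K = 2 ^ x := by
    rw [Subgroup.inf_relIndex_right, Subgroup.relIndex_ker, hxcard]
  have hYindex : Y.index = 2 ^ (k + x) := by
    rw [← Subgroup.relIndex_mul_index (show Y ≤ K from inf_le_right), hrel, hKindex, pow_add,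
      mul_comm]
  have hYc : Y ≤ Subgroup.center H := by
    intro y hy
    rw [Subgroup.mem_center_iff]
    intro z
    refine hext _ _ ?_ ?_
    · rw [map_mul, map_mul]
      exact Subgroup.mem_center_iff.1 (hZc hy.2) _
    · have : π₂ y = 1 := hy.1
      rw [map_mul, map_mul, this, one_mul, mul_one]
  have hY2 : ∀ y ∈ Y, y * y = 1 := by
    intro y hy
    refine hext _ _ ?_ ?_
    · rw [map_mul, map_one]
      exact hZ2 _ hy.2
    · have : π₂ y = 1 := hy.1
      rw [map_mul, this, map_one, one_mul]
  obtain ⟨ρ, hρ⟩ : ∃ ρ, Nat.card Y = 2 ^ ρ := by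
    have : IsPGroup 2 Y := fun y => ⟨1, by
      rw [pow_one, pow_two]
      exact Subtype.ext (hY2 y y.2)⟩
    exact IsPGroup.iff_card.1 this
  have hρR : R ≤ ρ + x := by
    have h1 : Nat.card Y * 2 ^ x = Nat.card K := by
      have := Subgroup.relIndex_mul_relIndex ⊥ Y K bot_le inf_le_right
      rwa [Subgroup.relIndex_bot_left, Subgroup.relIndex_bot_left, hrel] at this
    have h2 : Nat.card Z ≤ Nat.card K := by
      have : K.map π₁ = Z := Subgroup.map_comap_eq_self_of_surjective hπ₁ Z
      rw [← this]
      exact Nat.card_le_card_of_surjective _ (π₁.subgroupMap_surjective K)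
    rw [← h1, hρ, hZcard, ← pow_add] at h2
    exact (Nat.pow_le_pow_iff_right (by norm_num)).1 h2
  refine ⟨x, ρ, hx.trans hμ, hρR, ?_⟩
  rintro t J m htJ hm
  obtain ⟨F, hFinj, hFle, hFcard⟩ := exists_subgroup_family (Z := Y)
    (fun y hy z _ => (Subgroup.mem_center_iff.1 (hYc hy) z).symm) hY2 (by rw [hρ, htJ])
  have hFN : ∀ T, (F T).Normal := fun T => ⟨fun y hy z => by
    rwa [Subgroup.mem_center_iff.1 (hYc (hFle T hy)) z, mul_inv_cancel_right]⟩
  have hquot : ∀ T, Nat.card (H ⧸ F T) = 2 ^ m := by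
    intro T
    have h1 : (F T).index * Nat.card (F T) = Nat.card H := Subgroup.index_mul_card _
    have h2 : Y.index * Nat.card Y = Nat.card H := Subgroup.index_mul_card _
    rw [← h2, hFcard, hYindex, hρ, ← pow_add, show k + x + ρ = m + t by omega, pow_add] at h1
    exact Nat.eq_of_mul_eq_mul_right (by positivity) h1
  rw [← natCard_linearMap_zmod_two]
  have : Finite ((Fin t → ZMod 2) →ₗ[ZMod 2] (Fin J → ZMod 2)) := DFunLike.finite _
  refine natCard_le_mul_ncard_of_quotients hhcl F hFinj hquot
    ((involutionGroupClasses_finite d m).subset (selfNormalizingClasses_subset d m)) fun T => ?_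
  let s : Fin d → H ⧸ F T := fun i => QuotientGroup.mk (h i)
  let θ : H ⧸ F T →* M := QuotientGroup.lift (F T) π₂ fun y hy => (hFle T hy).1
  have hθ : ∀ i, θ (s i) = u i := fun i => rfl
  have hs2 : ∀ i, orderOf (s i) = 2 := by
    intro i
    refine orderOf_eq_prime ?_ fun hi => ?_
    · have : h i * h i = 1 := hext _ _ (hg i) (huu i)
      rw [pow_two, ← QuotientGroup.mk_mul, this, QuotientGroup.mk_one]
    · have := hu2 i
      rw [← hθ, hi, map_one, orderOf_one] at this
      omega
  have hord : ∀ i j, i ≠ j → orderOf (s i * s j) = orderOf (u i * u j) := by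
    intro i j hij
    refine Nat.dvd_antisymm (orderOf_dvd_of_pow_eq_one ?_) ?_
    -- The order of u i * u j is a multiple of 2^a, which kills Γ, so the Γ-component adds nothing
    -- to the order.
    · obtain ⟨c, hc⟩ : 2 ^ a ∣ orderOf (u i * u j) :=
        (pow_dvd_pow 2 (Nat.le_succ a)).trans (hudvd i j hij)
      have : (h i * h j) ^ orderOf (u i * u j) = 1 := by
        refine hext _ _ ?_ ?_
        · rw [map_pow, hc, pow_mul, hexp, one_pow, map_one]
        · rw [map_pow, map_one]
          exact pow_orderOf_eq_one (u i * u j)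
      rw [← QuotientGroup.mk_mul, ← QuotientGroup.mk_pow, this, QuotientGroup.mk_one]
    · have := orderOf_map_dvd θ (s i * s j)
      rwa [map_mul, hθ, hθ] at this
  have hinj : Function.Injective s := by
    intro i j hij
    by_contra hne
    have h1 := hudvd i j hne
    rw [← hord i j hne, hij, ← pow_two, ← hs2 j, pow_orderOf_eq_one, orderOf_one, hs2 j] at h1
    have := Nat.le_of_dvd one_pos h1
    have : 1 < 2 ^ (a + 1) := Nat.one_lt_two_pow (by omega)
    omega
  have hscl : Subgroup.closure (Set.range s) = ⊤ := by
    have := congrArg (Subgroup.map (QuotientGroup.mk' (F T))) hhcl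
    rw [MonoidHom.map_closure, ← MonoidHom.range_eq_map,
      MonoidHom.range_eq_top.2 (QuotientGroup.mk'_surjective _), ← Set.range_comp] at this
    exact this
  exact ⟨_, rfl, hquot T, Set.range s, isSelfNormalizingCayley_range_of_orders hd hs2 hscl
    (fun i j k l hij hkl he => huord i j k l hij hkl (by rw [← hord i j hij, he, hord k l hkl]))
    hinj⟩

/-! ### Choice of parameters and asymptotics -/

theorem natLog_isLittleO_natCast (b : ℕ) :
    (fun m : ℕ => (Nat.log b m : ℝ)) =o[Filter.atTop] (fun m : ℕ => (m : ℝ)) := by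
  have h1 : (fun m : ℕ => (Nat.log b m : ℝ)) =O[Filter.atTop] (fun m : ℕ => Real.log m) := by
    refine Asymptotics.IsBigO.of_bound (Real.log b)⁻¹ (Filter.Eventually.of_forall fun m => ?_)
    rw [Real.norm_of_nonneg (Nat.cast_nonneg _), Real.norm_of_nonneg (Real.log_natCast_nonneg m)]
    have := Real.natLog_le_logb m b
    rwa [Real.logb, div_eq_inv_mul] at this
  exact h1.trans_isLittleO
    (Real.isLittleO_log_id_atTop.comp_tendsto tendsto_natCast_atTop_atTop)

/-- The count of classes for a group of order `2 ^ m` in terms of the parameter `n` of the tower. -/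
theorem exists_parameters_pow_le {δ : ℕ} (hδ : 1 ≤ δ) {n s : ℕ} (hn : n ≤ 2 ^ s) :
    ∃ x ρ, x ≤ (δ + 2) ^ 2 * (s + 5 + (δ + 2) ^ 2) ∧ n * δ ^ 2 ≤ ρ + x ∧
      ∀ t J m, t + J = ρ → 2 * n * δ + s + 1 + x + J = m →
        2 ^ (t * J) ≤ 2 ^ (m * (δ + 2)) * (selfNormalizingClasses (δ + 2) m).ncard := by
  obtain ⟨Γ, _, _, g, Z, hg, hcl, hZc, hZ2, hZcard, hZindex, hexp⟩ := exists_involution_tower δ hn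
  exact exists_pow_le_ncard_selfNormalizingClasses (by omega) hg hcl hZc hZ2 hZcard hZindex hexp

-- E bounds the logarithmic cost of the dihedral group and of M together with the rounding of n;
-- `hE1` and `hE2` keep the resulting lower bounds for J and t nonnegative. The loss (δ + 2)(E + 1)m
-- covers the cross terms and the factor 2^(md) of repeated classes.
set_option maxHeartbeats 400000 in
theorem le_ncard_selfNormalizingClasses {δ : ℕ} (hδ : 1 ≤ δ) {m : ℕ} {E : ℝ}
    (hE : ((δ + 2 : ℕ) : ℝ) ^ 2 * (Nat.log 2 m + 6 + ((δ + 2 : ℕ) : ℝ) ^ 2) + Nat.log 2 m + 2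
      + (δ : ℝ) ^ 2 + 2 * δ ≤ E)
    (hE1 : E ≤ (δ : ℝ) / (2 * (δ + 2)) * m) (hE2 : E ≤ (δ : ℝ) / 4 * m) :
    (2 : ℝ) ^ ((δ : ℝ) ^ 2 / (8 * (δ + 2)) * (m : ℝ) ^ 2 - (δ + 2) * (E + 1) * m) ≤
      (selfNormalizingClasses (δ + 2) m).ncard := by
  set s := Nat.log 2 m + 1 with hs
  -- The maximum of (m - 2nδ)(nδ(δ + 2) - m), at the midpoint of its zeros in n.
  set n := m * (δ + 4) / (4 * δ * (δ + 2)) with hn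
  have hδpos : (0 : ℝ) < δ := by exact_mod_cast hδ
  have hden : 0 < 4 * δ * (δ + 2) := by positivity
  have hn1 : n * (4 * δ * (δ + 2)) ≤ m * (δ + 4) := Nat.div_mul_le_self _ _
  have hn2 : m * (δ + 4) ≤ (n + 1) * (4 * δ * (δ + 2)) := by
    rw [mul_comm (n + 1)]
    exact (Nat.lt_mul_div_succ _ hden).le
  have hns : n ≤ 2 ^ s := by
    have h1 : m < 2 ^ s := Nat.lt_pow_succ_log_self one_lt_two m
    have h2 : n * (4 * δ * (δ + 2)) ≤ m * (4 * δ * (δ + 2)) :=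
      hn1.trans (Nat.mul_le_mul_left _ (by nlinarith))
    exact (Nat.le_of_mul_le_mul_right h2 hden).trans h1.le
  obtain ⟨x, ρ, hx, hρ, hmain⟩ := exists_parameters_pow_le hδ hns
  have hx' : (x : ℝ) ≤ ((δ + 2 : ℕ) : ℝ) ^ 2 * (Nat.log 2 m + 6 + ((δ + 2 : ℕ) : ℝ) ^ 2) := by
    have : x ≤ (δ + 2) ^ 2 * (Nat.log 2 m + 6 + (δ + 2) ^ 2) := by
      convert hx using 3
    exact_mod_cast this
  have hn1' : (n : ℝ) * (4 * δ * (δ + 2)) ≤ m * (δ + 4) := by exact_mod_cast hn1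
  have hn2' : (m : ℝ) * (δ + 4) ≤ (n + 1) * (4 * δ * (δ + 2)) := by exact_mod_cast hn2
  have hρ' : (n : ℝ) * δ ^ 2 ≤ ρ + x := by exact_mod_cast hρ
  have hs' : (s : ℝ) = Nat.log 2 m + 1 := by rw [hs]; push_cast; rfl
  have hD2 : (0 : ℝ) < δ + 2 := by positivity
  have hβ : (δ : ℝ) / (2 * (δ + 2)) * m = m - m * (δ + 4) / (2 * (δ + 2)) := by
    field_simp; ring
  have hγ : (δ : ℝ) / 4 * m =
      m * (δ + 4) / (4 * δ * (δ + 2)) * δ ^ 2 - δ / (2 * (δ + 2)) * m := by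
    field_simp; ring
  have hnle : (n : ℝ) ≤ m * (δ + 4) / (4 * δ * (δ + 2)) := by
    rw [le_div_iff₀ (by positivity)]; exact hn1'
  have hnge : (m : ℝ) * (δ + 4) / (4 * δ * (δ + 2)) ≤ n + 1 := by
    rw [div_le_iff₀ (by positivity)]; exact hn2'
  have h2n : (m : ℝ) * (δ + 4) / (2 * (δ + 2)) = 2 * δ * (m * (δ + 4) / (4 * δ * (δ + 2))) := by
    field_simp; ring
  set A : ℝ := m * (δ + 4) / (4 * δ * (δ + 2)) with hA
  set β : ℝ := δ / (2 * (δ + 2)) * m with hβdef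
  have hL : (0 : ℝ) ≤ Nat.log 2 m := Nat.cast_nonneg _
  have hx0 : (0 : ℝ) ≤ x := Nat.cast_nonneg _
  have hnA : (n : ℝ) * δ ≤ A * δ := mul_le_mul_of_nonneg_right hnle hδpos.le
  have hAn : A * δ ≤ n * δ + δ := by nlinarith
  have hAn2 : A * (δ : ℝ) ^ 2 ≤ n * (δ : ℝ) ^ 2 + (δ : ℝ) ^ 2 := by nlinarith [sq_nonneg (δ : ℝ)]
  generalize ((δ + 2 : ℕ) : ℝ) ^ 2 * (Nat.log 2 m + 6 + ((δ + 2 : ℕ) : ℝ) ^ 2) = X at hx' hE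
  have hδsq : (0 : ℝ) ≤ (δ : ℝ) ^ 2 := sq_nonneg _
  rw [h2n] at hβ
  have hkm : 2 * n * δ + s + 1 + x ≤ m := by
    have : (2 * n * δ + s + 1 + x : ℝ) ≤ m := by
      rw [hs']
      linarith
    exact_mod_cast this
  obtain ⟨J, hJ⟩ := Nat.exists_eq_add_of_le hkm
  have hJ' : (m : ℝ) = 2 * n * δ + s + 1 + x + J := by exact_mod_cast hJ
  have hJlow : β - E ≤ J := by linarith
  have hs0 : (0 : ℝ) ≤ s := Nat.cast_nonneg _
  have hJup : (J : ℝ) ≤ β + 2 * δ := by linarith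
  have htlow : (δ : ℝ) / 4 * m - E ≤ ρ - J := by linarith
  obtain ⟨t, ht⟩ := Nat.exists_eq_add_of_le (show J ≤ ρ by
    have : (J : ℝ) ≤ ρ := by linarith
    exact_mod_cast this)
  have ht' : (ρ : ℝ) = J + t := by exact_mod_cast ht
  have hcount := hmain t J m (by omega) hJ.symm
  have hcount' : (2 : ℝ) ^ (t * J) ≤
      2 ^ (m * (δ + 2)) * (selfNormalizingClasses (δ + 2) m).ncard := by exact_mod_cast hcount
  have hE0 : 0 ≤ E := by linarith
  have hprod : ((δ : ℝ) / 4 * m - E) * (β - E) ≤ t * J := by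
    refine mul_le_mul (by linarith) hJlow (by linarith) (Nat.cast_nonneg _)
  have hβle : (δ : ℝ) / 4 * m + β ≤ (δ + 2) * m := by
    have : (δ : ℝ) / (2 * (δ + 2)) ≤ 1 := by
      rw [div_le_one (by positivity)]; linarith
    have hm0 : (0 : ℝ) ≤ m := Nat.cast_nonneg _
    have h1 : β ≤ 1 * m := mul_le_mul_of_nonneg_right this hm0
    have h2 : (δ : ℝ) / 4 * m ≤ δ * m := mul_le_mul_of_nonneg_right (by linarith) hm0
    linarith
  have hexpo : (δ : ℝ) ^ 2 / (8 * (δ + 2)) * (m : ℝ) ^ 2 - (δ + 2) * (E + 1) * m ≤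
      ((t * J : ℕ) : ℝ) - ((m * (δ + 2) : ℕ) : ℝ) := by
    push_cast
    have hmainterm : (δ : ℝ) ^ 2 / (8 * (δ + 2)) * (m : ℝ) ^ 2 = (δ : ℝ) / 4 * m * β := by
      rw [hβdef]; field_simp; ring
    rw [hmainterm]
    have h1 : (δ : ℝ) / 4 * m * β = ((δ : ℝ) / 4 * m - E) * (β - E) +
        E * ((δ : ℝ) / 4 * m + β) - E ^ 2 := by ring
    have h2 : ((δ : ℝ) + 2) * (E + 1) * m = E * ((δ + 2) * m) + m * (δ + 2) := by ring
    rw [h1, h2]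
    have h3 := mul_le_mul_of_nonneg_left hβle hE0
    have h4 := sq_nonneg E
    linarith only [h3, h4, hprod]
  refine (Real.rpow_le_rpow_of_exponent_le one_le_two hexpo).trans ?_
  rw [Real.rpow_sub two_pos, Real.rpow_natCast, Real.rpow_natCast, div_le_iff₀ (by positivity),
    mul_comm _ ((2 : ℝ) ^ _)]
  exact hcount'

/-- E(m) is O(log m), so the error (δ + 2)(E + 1)m is o(m²) and both smallness conditions on E hold
eventually. -/
theorem exists_isLittleO_le_ncard_selfNormalizingClasses {d : ℕ} (hd : 3 ≤ d) :
    ∃ e : ℕ → ℝ, Asymptotics.IsLittleO Filter.atTop e (fun m : ℕ => (m : ℝ) ^ 2) ∧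
      ∀ᶠ m : ℕ in Filter.atTop,
        (2 : ℝ) ^ (((d : ℝ) - 2) ^ 2 / (8 * (d : ℝ)) * (m : ℝ) ^ 2 + e m) ≤
          ((selfNormalizingClasses d m).ncard : ℝ) := by
  obtain ⟨δ, rfl⟩ := Nat.exists_eq_add_of_le' (show 2 ≤ d by omega)
  have hδ : 1 ≤ δ := by omega
  have hδpos : (0 : ℝ) < δ := by exact_mod_cast hδ
  let E : ℕ → ℝ := fun m =>
    ((δ + 2 : ℕ) : ℝ) ^ 2 * (Nat.log 2 m + 6 + ((δ + 2 : ℕ) : ℝ) ^ 2) + Nat.log 2 m + 2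
      + (δ : ℝ) ^ 2 + 2 * δ
  have hconst : ∀ c : ℝ, (fun _ : ℕ => c) =o[Filter.atTop] (fun m : ℕ => (m : ℝ)) := fun c =>
    (Asymptotics.isLittleO_const_id_atTop c).comp_tendsto tendsto_natCast_atTop_atTop
  have hlog := natLog_isLittleO_natCast 2
  have hE : E =o[Filter.atTop] (fun m : ℕ => (m : ℝ)) :=
    ((((((hlog.add (hconst 6)).add (hconst _)).const_mul_left _).add hlog).add (hconst 2)).add
      (hconst _)).add (hconst _)
  refine ⟨fun m => -((δ + 2) * (E m + 1) * m), ?_, ?_⟩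
  · have h := (((hE.add (hconst 1)).const_mul_left ((δ : ℝ) + 2)).mul_isBigO
      (Asymptotics.isBigO_refl (fun m : ℕ => (m : ℝ)) Filter.atTop)).neg_left
    refine h.congr_right fun m => ?_
    rw [pow_two]
  · have hbound : ∀ c : ℝ, 0 < c → ∀ᶠ m : ℕ in Filter.atTop, E m ≤ c * m := by
      intro c hc
      filter_upwards [hE.bound hc] with m hm
      rw [Real.norm_of_nonneg (Nat.cast_nonneg m)] at hm
      exact (le_abs_self _).trans hm
    filter_upwards [hbound (δ / (2 * (δ + 2))) (by positivity), hbound (δ / 4) (by positivity)]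
      with m h1 h2
    refine le_trans (le_of_eq ?_) (le_ncard_selfNormalizingClasses (E := E m) hδ le_rfl h1 h2)
    congr 1
    push_cast
    ring

theorem theorem5 (d : ℕ) (hd : 3 ≤ d) :
    (∃ e : ℕ → ℝ, Asymptotics.IsLittleO Filter.atTop e (fun m : ℕ => (m : ℝ) ^ 2) ∧
      ∀ᶠ m : ℕ in Filter.atTop,
        (2 : ℝ) ^ (((d : ℝ) - 2) ^ 2 / (8 * (d : ℝ)) * (m : ℝ) ^ 2 + e m) ≤
          (numInvolutionGroups d m : ℝ)) ∧
    (∃ e : ℕ → ℝ, Asymptotics.IsLittleO Filter.atTop e (fun m : ℕ => (m : ℝ) ^ 2) ∧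
      ∀ᶠ m : ℕ in Filter.atTop,
        (2 : ℝ) ^ (((d : ℝ) - 2) ^ 2 / (8 * (d : ℝ)) * (m : ℝ) ^ 2 + e m) ≤
          (numSelfNormalizingCayleyGraphs d m : ℝ)) := by
  obtain ⟨e, he, hle⟩ := exists_isLittleO_le_ncard_selfNormalizingClasses hd
  refine ⟨⟨e, he, hle.mono fun m h => h.trans ?_⟩, ⟨e, he, hle.mono fun m h => h.trans ?_⟩⟩
  · exact_mod_cast ncard_selfNormalizingClasses_le_groups d m
  · exact_mod_cast ncard_selfNormalizingClasses_le_graphs d m
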